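/- Let $\mathbb{K}=\mathbb{R}$ or $\mathbb{C}$ and $\mathbb{N}=\{1,2,3,\dots\}$. A finite set $F\subset\mathbb{N}$ is a \emph{Schreier set} if $F=\emptyset$ or $|F|\le\min F$; a \emph{Schreier chain} is a non-empty finite collection $\mathcal{C}=\{F_1,\dots,F_m\}$ of non-empty Schreier sets with $\max F_j<\min F_{j+1}$ for $1\le j<m$. For $x\in\mathbb{K}^{\mathbb{N}}$ put \[ \|x\|_{S_p}=\sup\Bigl\{\Bigl(\sum_{n\in F}|x(n)|^p\Bigr)^{1/p} : F \text{ a Schreier set}\Bigr\}\quad(1\le p<\infty), \] \[ \|x\|_{B_p}=\sup\Bigl\{\Bigl(\sum_{F\in\mathcal{C}}\Bigl(\sum_{n\in F}|x(n)|\Bigr)^p\Bigr)^{1/p} : \mathcal{C} \text{ a Schreier chain}\Bigr\}\quad(1<p<\infty). \] The Baernstein space is $B_p=\{x\in\mathbb{K}^{\mathbb{N}}:\|x\|_{B_p}<\infty\}$ with norm $\|\cdot\|_{B_p}$, and the $p$-convexified Schreier space $S_p$ is the closed linear span of the unit vectors $e_1,e_2,\dots$ in $\{x\in\mathbb{K}^{\mathbb{N}}:\|x\|_{S_p}<\infty\}$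 with norm $\|\cdot\|_{S_p}$. Let $(E,D)=(B_p,\ell_p)$ for some $1<p<\infty$, or $(E,D)=(S_p,c_0)$ for some $1\le p<\infty$, and let $T\colon E\to E$ be a bounded linear operator. Then the following conditions are equivalent: (a) $T$ is finitely strictly singular, that is, for every $\varepsilon>0$ there is $n\in\mathbb{N}$ such that every subspace of $E$ of dimension at least $n$ contains a unit vector $x$ with $\|Tx\|\le\varepsilon$; (b) $T$ is strictly singular, that is, no restriction of $T$ to an infinite-dimensional subspace of $E$ is an isomorphic embedding; (c) $T$ does not fix a copy of $D$, that is, there is no subspace $W$ of $E$ isomorphic to $D$ such that $T|_W$ is an isomorphic embedding; (d) the identity operator on $D$ does not factor through $T$, that is, there are no bounded linear operators $U\colon D\to E$ and $V\colon E\to D$ with $VTU=I_D$. -/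

import Mathlib

open scoped NNReal ENNReal ZeroAtInfty

namespace BaernsteinSchreier

noncomputable section

/-! ### Schreier sets and Schreier chains

Sequences are indexed by `ℕ = {0, 1, 2, …}`: the index `n` stands for the positive integer `n + 1`. -/

/-- `F` is a Schreier set: it is empty or `|F| ≤ min F`, where the index `n` stands for the
positive integer `n + 1`. -/
def IsSchreier (F : Finset ℕ) : Prop :=
  ∀ n ∈ F, F.card ≤ n + 1

/-- `F < G` in the sense that `max F < min G`. -/
def SetLT (F G : Finset ℕ) : Prop :=
  ∀ a ∈ F, ∀ b ∈ G, a < b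

/-- A Schreier chain: a non-empty finite collection of non-empty Schreier sets which can be
enumerated as `F₁ < F₂ < ⋯ < Fₘ`. -/
structure IsSchreierChain (C : Finset (Finset ℕ)) : Prop where
  nonempty : C.Nonempty
  nonempty_of_mem : ∀ F ∈ C, F.Nonempty
  isSchreier_of_mem : ∀ F ∈ C, IsSchreier F
  consecutive : ∀ F ∈ C, ∀ G ∈ C, F ≠ G → SetLT F G ∨ SetLT G F

variable {𝕜 : Type*} [RCLike 𝕜]

/-! ### The Schreier norm and the Baernstein norm -/

/-- `μ_p(x, F) = (∑_{n ∈ F} |x(n)|^p)^{1/p}`. -/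
def mu (p : ℝ≥0) (x : ℕ → 𝕜) (F : Finset ℕ) : ℝ :=
  (∑ n ∈ F, ‖x n‖ ^ (p : ℝ)) ^ (1 / (p : ℝ))

/-- `β_p(x, C) = (∑_{F ∈ C} (∑_{n ∈ F} |x(n)|)^p)^{1/p}`. -/
def beta (p : ℝ≥0) (x : ℕ → 𝕜) (C : Finset (Finset ℕ)) : ℝ :=
  (∑ F ∈ C, (∑ n ∈ F, ‖x n‖) ^ (p : ℝ)) ^ (1 / (p : ℝ))

/-- The Schreier norm of an arbitrary scalar sequence, with values in `[0, ∞]`. -/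
def schreierENorm (p : ℝ≥0) (x : ℕ → 𝕜) : ℝ≥0∞ :=
  ⨆ (F : Finset ℕ) (_ : IsSchreier F), ENNReal.ofReal (mu p x F)

/-- The Baernstein norm of an arbitrary scalar sequence, with values in `[0, ∞]`. -/
def baernsteinENorm (p : ℝ≥0) (x : ℕ → 𝕜) : ℝ≥0∞ :=
  ⨆ (C : Finset (Finset ℕ)) (_ : IsSchreierChain C), ENNReal.ofReal (beta p x C)

/-! ### Facts needed to see that these are norms -/

theorem mu_add_le {p : ℝ≥0} (hp : 1 ≤ p) (x y : ℕ → 𝕜) (F : Finset ℕ) :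
    mu p (x + y) F ≤ mu p x F + mu p y F := by
  have hp' : (1 : ℝ) ≤ p := by exact_mod_cast hp
  refine le_trans ?_ (Real.Lp_add_le_of_nonneg F hp' (f := fun n => ‖x n‖) (g := fun n => ‖y n‖)
    (fun _ _ => norm_nonneg _) (fun _ _ => norm_nonneg _))
  unfold mu
  gcongr with n _
  exact norm_add_le _ _

theorem mu_smul {p : ℝ≥0} (hp : 1 ≤ p) (c : 𝕜) (x : ℕ → 𝕜) (F : Finset ℕ) :
    mu p (c • x) F = ‖c‖ * mu p x F := by
  have hp' : (p : ℝ) ≠ 0 := by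
    have : (1 : ℝ) ≤ p := by exact_mod_cast hp
    positivity
  simp only [mu, Pi.smul_apply, norm_smul]
  simp_rw [Real.mul_rpow (norm_nonneg _) (norm_nonneg _)]
  rw [← Finset.mul_sum, Real.mul_rpow (by positivity) (by positivity), one_div,
    Real.rpow_rpow_inv (norm_nonneg _) hp']

theorem beta_add_le {p : ℝ≥0} (hp : 1 ≤ p) (x y : ℕ → 𝕜) (C : Finset (Finset ℕ)) :
    beta p (x + y) C ≤ beta p x C + beta p y C := by
  have hp' : (1 : ℝ) ≤ p := by exact_mod_cast hp
  refine le_trans ?_ (Real.Lp_add_le_of_nonneg C hp' (f := fun F => ∑ n ∈ F, ‖x n‖)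
    (g := fun F => ∑ n ∈ F, ‖y n‖)
    (fun _ _ => by positivity) (fun _ _ => by positivity))
  unfold beta
  gcongr with F _
  rw [← Finset.sum_add_distrib]
  gcongr with n _
  exact norm_add_le _ _

theorem beta_smul {p : ℝ≥0} (hp : 1 ≤ p) (c : 𝕜) (x : ℕ → 𝕜) (C : Finset (Finset ℕ)) :
    beta p (c • x) C = ‖c‖ * beta p x C := by
  have hp' : (p : ℝ) ≠ 0 := by
    have : (1 : ℝ) ≤ p := by exact_mod_cast hp
    positivity
  simp only [beta, Pi.smul_apply, norm_smul]
  simp_rw [← Finset.mul_sum]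
  have h : ∀ F : Finset ℕ, (‖c‖ * ∑ n ∈ F, ‖x n‖) ^ (p : ℝ)
      = ‖c‖ ^ (p : ℝ) * (∑ n ∈ F, ‖x n‖) ^ (p : ℝ) := fun F =>
    Real.mul_rpow (norm_nonneg _) (by positivity)
  simp_rw [h]
  rw [← Finset.mul_sum, Real.mul_rpow (by positivity) (by positivity), one_div,
    Real.rpow_rpow_inv (norm_nonneg _) hp']

theorem mu_singleton {p : ℝ≥0} (hp : 1 ≤ p) (x : ℕ → 𝕜) (n : ℕ) : mu p x {n} = ‖x n‖ := by
  have hp' : (p : ℝ) ≠ 0 := by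
    have : (1 : ℝ) ≤ p := by exact_mod_cast hp
    positivity
  simp only [mu, Finset.sum_singleton, one_div]
  exact Real.rpow_rpow_inv (norm_nonneg _) hp'

theorem beta_singleton {p : ℝ≥0} (hp : 1 ≤ p) (x : ℕ → 𝕜) (n : ℕ) :
    beta p x {{n}} = ‖x n‖ := by
  have hp' : (p : ℝ) ≠ 0 := by
    have : (1 : ℝ) ≤ p := by exact_mod_cast hp
    positivity
  simp only [beta, Finset.sum_singleton, one_div]
  exact Real.rpow_rpow_inv (norm_nonneg _) hp'

theorem isSchreier_singleton (n : ℕ) : IsSchreier {n} := by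
  intro m _
  simp

theorem isSchreierChain_singleton (n : ℕ) : IsSchreierChain {{n}} where
  nonempty := by simp
  nonempty_of_mem := by simp
  isSchreier_of_mem := by simpa using isSchreier_singleton n
  consecutive := by simp

theorem schreierENorm_add_le {p : ℝ≥0} (hp : 1 ≤ p) (x y : ℕ → 𝕜) :
    schreierENorm p (x + y) ≤ schreierENorm p x + schreierENorm p y := by
  refine iSup₂_le fun F hF => ?_
  refine (ENNReal.ofReal_le_ofReal (mu_add_le hp x y F)).trans (ENNReal.ofReal_add_le.trans ?_)
  exact add_le_add (le_iSup₂ (f := fun F (_ : IsSchreier F) => ENNReal.ofReal (mu p x F)) F hF)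
    (le_iSup₂ (f := fun F (_ : IsSchreier F) => ENNReal.ofReal (mu p y F)) F hF)

theorem schreierENorm_smul {p : ℝ≥0} (hp : 1 ≤ p) (c : 𝕜) (x : ℕ → 𝕜) :
    schreierENorm p (c • x) = ENNReal.ofReal ‖c‖ * schreierENorm p x := by
  simp only [schreierENorm, ENNReal.mul_iSup, mu_smul hp, ENNReal.ofReal_mul (norm_nonneg c)]

theorem norm_le_schreierENorm {p : ℝ≥0} (hp : 1 ≤ p) (x : ℕ → 𝕜) (n : ℕ) :
    ENNReal.ofReal ‖x n‖ ≤ schreierENorm p x := by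
  rw [← mu_singleton hp x n]
  exact le_iSup₂ (f := fun F (_ : IsSchreier F) => ENNReal.ofReal (mu p x F)) {n}
    (isSchreier_singleton n)

theorem baernsteinENorm_add_le {p : ℝ≥0} (hp : 1 ≤ p) (x y : ℕ → 𝕜) :
    baernsteinENorm p (x + y) ≤ baernsteinENorm p x + baernsteinENorm p y := by
  refine iSup₂_le fun C hC => ?_
  refine (ENNReal.ofReal_le_ofReal (beta_add_le hp x y C)).trans (ENNReal.ofReal_add_le.trans ?_)
  exact add_le_add
    (le_iSup₂ (f := fun C (_ : IsSchreierChain C) => ENNReal.ofReal (beta p x C)) C hC)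
    (le_iSup₂ (f := fun C (_ : IsSchreierChain C) => ENNReal.ofReal (beta p y C)) C hC)

theorem baernsteinENorm_smul {p : ℝ≥0} (hp : 1 ≤ p) (c : 𝕜) (x : ℕ → 𝕜) :
    baernsteinENorm p (c • x) = ENNReal.ofReal ‖c‖ * baernsteinENorm p x := by
  simp only [baernsteinENorm, ENNReal.mul_iSup, beta_smul hp, ENNReal.ofReal_mul (norm_nonneg c)]

theorem norm_le_baernsteinENorm {p : ℝ≥0} (hp : 1 ≤ p) (x : ℕ → 𝕜) (n : ℕ) :
    ENNReal.ofReal ‖x n‖ ≤ baernsteinENorm p x := by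
  have h := le_iSup₂ (f := fun C (_ : IsSchreierChain C) => ENNReal.ofReal (beta p x C)) _
    (isSchreierChain_singleton n)
  rwa [beta_singleton hp x n] at h

theorem mu_single_le {p : ℝ≥0} (hp : 1 ≤ p) (n : ℕ) (F : Finset ℕ) :
    mu p (Pi.single n (1 : 𝕜)) F ≤ 1 := by
  have hp' : 0 < (p : ℝ) := by
    have : (1 : ℝ) ≤ p := by exact_mod_cast hp
    positivity
  have hs : ∀ m, ‖(Pi.single n (1 : 𝕜) : ℕ → 𝕜) m‖ ^ (p : ℝ) = if m = n then 1 else 0 := by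
    intro m
    by_cases h : m = n
    · subst h; simp
    · simp [h, hp'.ne']
  simp only [mu, hs]
  refine Real.rpow_le_one (by positivity) ?_ (by positivity)
  rw [Finset.sum_ite_eq']
  split_ifs <;> norm_num

/-! ### The spaces

The type synonyms below carry only the norm topology, not that of coordinatewise convergence. -/

variable (𝕜)

/-- The scalar sequences of finite Schreier norm, as a subspace of all scalar sequences. -/
def schreierSubmodule (p : ℝ≥0) [hp : Fact (1 ≤ p)] : Submodule 𝕜 (ℕ → 𝕜) where
  carrier := {x | schreierENorm p x < ∞}
  zero_mem' := by
    have h := schreierENorm_smul hp.out (0 : 𝕜) (0 : ℕ → 𝕜)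
    simp only [zero_smul, norm_zero, ENNReal.ofReal_zero, zero_mul] at h
    simp [h]
  add_mem' := fun {x y} hx hy =>
    (schreierENorm_add_le hp.out x y).trans_lt (ENNReal.add_lt_top.2 ⟨hx, hy⟩)
  smul_mem' := fun c x hx => by
    simp only [Set.mem_ofPred_eq] at hx ⊢
    rw [schreierENorm_smul hp.out]
    exact ENNReal.mul_lt_top ENNReal.ofReal_lt_top hx

/-- The scalar sequences of finite Baernstein norm, as a subspace of all scalar sequences. -/
def baernsteinSubmodule (p : ℝ≥0) [hp : Fact (1 ≤ p)] : Submodule 𝕜 (ℕ → 𝕜) where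
  carrier := {x | baernsteinENorm p x < ∞}
  zero_mem' := by
    have h := baernsteinENorm_smul hp.out (0 : 𝕜) (0 : ℕ → 𝕜)
    simp only [zero_smul, norm_zero, ENNReal.ofReal_zero, zero_mul] at h
    simp [h]
  add_mem' := fun {x y} hx hy =>
    (baernsteinENorm_add_le hp.out x y).trans_lt (ENNReal.add_lt_top.2 ⟨hx, hy⟩)
  smul_mem' := fun c x hx => by
    simp only [Set.mem_ofPred_eq] at hx ⊢
    rw [baernsteinENorm_smul hp.out]
    exact ENNReal.mul_lt_top ENNReal.ofReal_lt_top hx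

/-- The space `Z_p` of all scalar sequences of finite Schreier norm. -/
def SchreierZ (p : ℝ≥0) [Fact (1 ≤ p)] : Type _ := ↥(schreierSubmodule 𝕜 p)

/-- The Baernstein space `B_p` of all scalar sequences of finite Baernstein norm. -/
def BaernsteinSpace (p : ℝ≥0) [Fact (1 ≤ p)] : Type _ := ↥(baernsteinSubmodule 𝕜 p)

namespace SchreierZ

variable (p : ℝ≥0) [hp : Fact (1 ≤ p)]

instance : AddCommGroup (SchreierZ 𝕜 p) := inferInstanceAs (AddCommGroup ↥(schreierSubmodule 𝕜 p))

instance : Module 𝕜 (SchreierZ 𝕜 p) := inferInstanceAs (Module 𝕜 ↥(schreierSubmodule 𝕜 p))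

instance : Norm (SchreierZ 𝕜 p) := ⟨fun x => (schreierENorm p x.1).toReal⟩

theorem normedSpaceCore : NormedSpace.Core 𝕜 (SchreierZ 𝕜 p) where
  norm_nonneg _ := ENNReal.toReal_nonneg
  norm_smul c x := by
    change (schreierENorm p (c • x.1)).toReal = ‖c‖ * (schreierENorm p x.1).toReal
    rw [schreierENorm_smul hp.out, ENNReal.toReal_mul, ENNReal.toReal_ofReal (norm_nonneg c)]
  norm_triangle x y := by
    change (schreierENorm p (x.1 + y.1)).toReal
      ≤ (schreierENorm p x.1).toReal + (schreierENorm p y.1).toReal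
    have hx : schreierENorm p x.1 < ∞ := x.2
    have hy : schreierENorm p y.1 < ∞ := y.2
    rw [← ENNReal.toReal_add hx.ne hy.ne]
    exact ENNReal.toReal_mono (ENNReal.add_lt_top.2 ⟨hx, hy⟩).ne
      (schreierENorm_add_le hp.out x.1 y.1)
  norm_eq_zero_iff x := by
    have hx : schreierENorm p x.1 < ∞ := x.2
    constructor
    · intro h
      have h0 : schreierENorm p x.1 = 0 := (ENNReal.toReal_eq_zero_iff _).1 h |>.resolve_right hx.ne
      refine Subtype.ext (funext fun n => ?_)
      have hn := norm_le_schreierENorm hp.out x.1 n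
      rw [h0, nonpos_iff_eq_zero, ENNReal.ofReal_eq_zero] at hn
      exact norm_le_zero_iff.1 hn
    · rintro rfl
      change (schreierENorm p (0 : ℕ → 𝕜)).toReal = 0
      have h := schreierENorm_smul hp.out (0 : 𝕜) (0 : ℕ → 𝕜)
      simp only [zero_smul, norm_zero, ENNReal.ofReal_zero, zero_mul] at h
      simp [h]

instance : NormedAddCommGroup (SchreierZ 𝕜 p) := NormedAddCommGroup.ofCore (normedSpaceCore 𝕜 p)

instance : NormedSpace 𝕜 (SchreierZ 𝕜 p) := NormedSpace.ofCore (normedSpaceCore 𝕜 p)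

/-- The unit vector `e_n` as an element of `Z_p`. -/
def unitVector (n : ℕ) : SchreierZ 𝕜 p :=
  ⟨Pi.single n 1, by
    change schreierENorm p (Pi.single n (1 : 𝕜)) < ∞
    refine lt_of_le_of_lt (iSup₂_le fun F _ => ?_) ENNReal.one_lt_top
    exact ENNReal.ofReal_le_one.2 (mu_single_le hp.out n F)⟩

end SchreierZ

/-- The `p`-convexified Schreier space `S_p`: the closed linear span in `Z_p` of the unit
vectors. -/
abbrev SchreierSpace (p : ℝ≥0) [Fact (1 ≤ p)] : Type _ :=
  ↥(Submodule.span 𝕜 (Set.range (SchreierZ.unitVector 𝕜 p))).topologicalClosure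

namespace BaernsteinSpace

variable (p : ℝ≥0) [hp : Fact (1 ≤ p)]

instance : AddCommGroup (BaernsteinSpace 𝕜 p) :=
  inferInstanceAs (AddCommGroup ↥(baernsteinSubmodule 𝕜 p))

instance : Module 𝕜 (BaernsteinSpace 𝕜 p) :=
  inferInstanceAs (Module 𝕜 ↥(baernsteinSubmodule 𝕜 p))

instance : Norm (BaernsteinSpace 𝕜 p) := ⟨fun x => (baernsteinENorm p x.1).toReal⟩

theorem normedSpaceCore : NormedSpace.Core 𝕜 (BaernsteinSpace 𝕜 p) where
  norm_nonneg _ := ENNReal.toReal_nonneg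
  norm_smul c x := by
    change (baernsteinENorm p (c • x.1)).toReal = ‖c‖ * (baernsteinENorm p x.1).toReal
    rw [baernsteinENorm_smul hp.out, ENNReal.toReal_mul, ENNReal.toReal_ofReal (norm_nonneg c)]
  norm_triangle x y := by
    change (baernsteinENorm p (x.1 + y.1)).toReal
      ≤ (baernsteinENorm p x.1).toReal + (baernsteinENorm p y.1).toReal
    have hx : baernsteinENorm p x.1 < ∞ := x.2
    have hy : baernsteinENorm p y.1 < ∞ := y.2
    rw [← ENNReal.toReal_add hx.ne hy.ne]
    exact ENNReal.toReal_mono (ENNReal.add_lt_top.2 ⟨hx, hy⟩).ne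
      (baernsteinENorm_add_le hp.out x.1 y.1)
  norm_eq_zero_iff x := by
    have hx : baernsteinENorm p x.1 < ∞ := x.2
    constructor
    · intro h
      have h0 : baernsteinENorm p x.1 = 0 :=
        (ENNReal.toReal_eq_zero_iff _).1 h |>.resolve_right hx.ne
      refine Subtype.ext (funext fun n => ?_)
      have hn := norm_le_baernsteinENorm hp.out x.1 n
      rw [h0, nonpos_iff_eq_zero, ENNReal.ofReal_eq_zero] at hn
      exact norm_le_zero_iff.1 hn
    · rintro rfl
      change (baernsteinENorm p (0 : ℕ → 𝕜)).toReal = 0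
      have h := baernsteinENorm_smul hp.out (0 : 𝕜) (0 : ℕ → 𝕜)
      simp only [zero_smul, norm_zero, ENNReal.ofReal_zero, zero_mul] at h
      simp [h]

instance : NormedAddCommGroup (BaernsteinSpace 𝕜 p) :=
  NormedAddCommGroup.ofCore (normedSpaceCore 𝕜 p)

instance : NormedSpace 𝕜 (BaernsteinSpace 𝕜 p) := NormedSpace.ofCore (normedSpaceCore 𝕜 p)

end BaernsteinSpace

instance factOneLeCoe (p : ℝ≥0) [hp : Fact (1 ≤ p)] : Fact (1 ≤ (p : ℝ≥0∞)) :=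
  ⟨by exact_mod_cast hp.out⟩

/-- The sequence space `ℓ_p`. -/
abbrev EllP (p : ℝ≥0) : Type _ := ↥(lp (fun _ : ℕ => 𝕜) (p : ℝ≥0∞))

/-- The sequence space `c₀` of null sequences with the supremum norm. -/
abbrev CZero : Type _ := C₀(ℕ, 𝕜)

variable {𝕜}

/-! ### Classes of operators -/

section Operators

variable {X Y : Type*} [NormedAddCommGroup X] [NormedSpace 𝕜 X]
  [NormedAddCommGroup Y] [NormedSpace 𝕜 Y]

/-- A bounded operator is an isomorphic embedding if it is bounded below. -/
def IsIsomorphicEmbedding (T : X →L[𝕜] Y) : Prop :=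
  ∃ c : ℝ, 0 < c ∧ ∀ x : X, c * ‖x‖ ≤ ‖T x‖

/-- No restriction of `T` to an infinite-dimensional subspace is an isomorphic embedding. -/
def IsStrictlySingular (T : X →L[𝕜] Y) : Prop :=
  ∀ W : Submodule 𝕜 X, ¬ FiniteDimensional 𝕜 W → ¬ IsIsomorphicEmbedding (T ∘L W.subtypeL)

/-- For every `ε > 0` there is `n` such that every subspace of dimension at least `n` (possibly
infinite) contains a unit vector `x` with `‖T x‖ ≤ ε`. -/
def IsFinitelyStrictlySingular (T : X →L[𝕜] Y) : Prop :=
  ∀ ε : ℝ, 0 < ε → ∃ n : ℕ, ∀ W : Submodule 𝕜 X, (n : Cardinal) ≤ Module.rank 𝕜 W →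
    ∃ x ∈ W, ‖x‖ = 1 ∧ ‖T x‖ ≤ ε

/-- `T` fixes a copy of `D`: its restriction to some subspace isomorphic to `D` is an isomorphic
embedding. -/
def FixesCopyOf (D : Type*) [NormedAddCommGroup D] [NormedSpace 𝕜 D] (T : X →L[𝕜] Y) : Prop :=
  ∃ W : Submodule 𝕜 X, Nonempty (D ≃L[𝕜] W) ∧ IsIsomorphicEmbedding (T ∘L W.subtypeL)

/-- The identity operator on `D` factors through `T`. -/
def IdFactorsThrough (D : Type*) [NormedAddCommGroup D] [NormedSpace 𝕜 D] (T : X →L[𝕜] Y) : Prop :=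
  ∃ (U : D →L[𝕜] X) (V : Y →L[𝕜] D), V ∘L T ∘L U = ContinuousLinearMap.id 𝕜 D

end Operators

end

end BaernsteinSchreier

open scoped NNReal ENNReal ZeroAtInfty

namespace BaernsteinSchreier

noncomputable section

open Filter Topology Finset

variable {𝕜 : Type*} [RCLike 𝕜] {E : Type*} [NormedAddCommGroup E] [NormedSpace 𝕜 E]

/-! ### Normed sequence spaces with a solid norm -/

/-- A normed space of scalar sequences containing the unit vectors, whose norm dominates the
coordinates and depends monotonically on their moduli. -/
structure SolidBasis (κ : E →ₗ[𝕜] (ℕ → 𝕜)) (e : ℕ → E) : Prop where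
  coord_basis : ∀ n, κ (e n) = Pi.single n 1
  norm_coord_le : ∀ x n, ‖κ x n‖ ≤ ‖x‖
  solid : ∀ x y, (∀ n, ‖κ x n‖ ≤ ‖κ y n‖) → ‖x‖ ≤ ‖y‖

/-- The truncation of a sequence to its first `n` coordinates. -/
def trunc (κ : E →ₗ[𝕜] (ℕ → 𝕜)) (e : ℕ → E) (n : ℕ) : E →ₗ[𝕜] E :=
  ∑ i ∈ range n, (LinearMap.proj i ∘ₗ κ).smulRight (e i)

theorem trunc_apply (κ : E →ₗ[𝕜] (ℕ → 𝕜)) (e : ℕ → E) (n : ℕ) (x : E) :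
    trunc κ e n x = ∑ i ∈ range n, κ x i • e i := by
  simp [trunc]

namespace SolidBasis

variable {κ : E →ₗ[𝕜] (ℕ → 𝕜)} {e : ℕ → E}

theorem coord_sum (h : SolidBasis κ e) (s : Finset ℕ) (c : ℕ → 𝕜) (k : ℕ) :
    κ (∑ i ∈ s, c i • e i) k = if k ∈ s then c k else 0 := by
  simp only [map_sum, map_smul, h.coord_basis, Finset.sum_apply, Pi.smul_apply, smul_eq_mul,
    Pi.single_apply, mul_ite, mul_one, mul_zero]
  simp

theorem coord_trunc (h : SolidBasis κ e) (n : ℕ) (x : E) (k : ℕ) :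
    κ (trunc κ e n x) k = if k < n then κ x k else 0 := by
  rw [trunc_apply, h.coord_sum]
  simp

theorem coord_trunc_sub_trunc (h : SolidBasis κ e) {m n : ℕ} (hmn : m ≤ n) (x : E) (k : ℕ) :
    κ (trunc κ e n x - trunc κ e m x) k = if m ≤ k ∧ k < n then κ x k else 0 := by
  rw [map_sub, Pi.sub_apply, h.coord_trunc, h.coord_trunc]
  split_ifs <;> first | omega | simp

theorem ext (h : SolidBasis κ e) {x y : E} (hxy : ∀ n, κ x n = κ y n) : x = y := by
  rw [← sub_eq_zero, ← norm_le_zero_iff, ← norm_zero (E := E)]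
  exact h.solid _ _ fun n => by simp [hxy n]

theorem norm_trunc_le (h : SolidBasis κ e) (n : ℕ) (x : E) : ‖trunc κ e n x‖ ≤ ‖x‖ := by
  refine h.solid _ _ fun k => ?_
  rw [h.coord_trunc]
  split_ifs <;> simp

theorem norm_trunc_sub_trunc_le (h : SolidBasis κ e) (m n : ℕ) (x : E) :
    ‖trunc κ e n x - trunc κ e m x‖ ≤ ‖x‖ := by
  refine h.solid _ _ fun k => ?_
  rw [map_sub, Pi.sub_apply, h.coord_trunc, h.coord_trunc]
  split_ifs <;> simp

theorem trunc_trunc (h : SolidBasis κ e) (m n : ℕ) (x : E) :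
    trunc κ e m (trunc κ e n x) = trunc κ e (min m n) x := by
  refine h.ext fun k => ?_
  simp only [h.coord_trunc, lt_min_iff]
  split_ifs <;> first | rfl | omega

/-- The norm is controlled by the coordinates on a finite initial segment when `‖e i‖ ≤ 1`. -/
theorem norm_trunc_le_mul (he : ∀ n, ‖e n‖ ≤ 1) {x : E} {η : ℝ} (n : ℕ)
    (hη : ∀ i, ‖κ x i‖ ≤ η) : ‖trunc κ e n x‖ ≤ n * η := by
  rw [trunc_apply]
  refine (norm_sum_le _ _).trans ?_
  have : ∀ i ∈ range n, ‖κ x i • e i‖ ≤ η := fun i _ => by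
    rw [norm_smul]
    have := mul_le_mul (hη i) (he i) (norm_nonneg _) ((norm_nonneg _).trans (hη i))
    linarith
  simpa using Finset.sum_le_sum this

theorem tendsto_coord (h : SolidBasis κ e)
    (ht : ∀ x, Tendsto (fun n => trunc κ e n x) atTop (𝓝 x)) (x : E) :
    Tendsto (κ x) atTop (𝓝 0) := by
  have h1 : Tendsto (fun n => ‖x - trunc κ e n x‖) atTop (𝓝 0) := by
    simpa using ((tendsto_const_nhds (x := x)).sub (ht x)).norm
  refine squeeze_zero_norm (fun n => ?_) h1
  have := h.norm_coord_le (x - trunc κ e n x) n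
  rwa [map_sub, Pi.sub_apply, h.coord_trunc, if_neg (lt_irrefl n), sub_zero] at this

end SolidBasis

/-! ### Flat vectors in finite-dimensional subspaces -/

theorem exists_norm_apply_eq_norm (z : C₀(ℕ, 𝕜)) (hz : 0 < ‖z‖) : ∃ i, ‖z i‖ = ‖z‖ := by
  have hle : ∀ i, ‖z i‖ ≤ ‖z‖ := fun i => z.toBCF.norm_coe_le_norm i
  by_contra! hne
  have hlt : ∀ i, ‖z i‖ < ‖z‖ := fun i => lt_of_le_of_ne (hle i) (hne i)
  have h0 : Tendsto (fun i => ‖z i‖) atTop (𝓝 0) := by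
    have := z.zero_at_infty'
    rw [cocompact_eq_cofinite, Nat.cofinite_eq_atTop] at this
    simpa using this.norm
  obtain ⟨N, hN⟩ := eventually_atTop.1 (h0.eventually (gt_mem_nhds (half_pos hz)))
  obtain ⟨r, hr0, hrz, hr⟩ : ∃ r, 0 ≤ r ∧ r < ‖z‖ ∧ ∀ i < N, ‖z i‖ ≤ r := by
    rcases N.eq_zero_or_pos with rfl | hNpos
    · exact ⟨0, le_rfl, hz, by simp⟩
    · obtain ⟨m, -, hm⟩ := exists_max_image (range N) (fun i => ‖z i‖) ⟨0, by simpa using hNpos⟩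
      exact ⟨‖z m‖, norm_nonneg _, hlt m, fun i hi => hm i (by simpa using hi)⟩
  have : ‖z.toBCF‖ ≤ max r (‖z‖ / 2) := by
    refine (BoundedContinuousFunction.norm_le (le_max_of_le_left hr0)).2 fun i => ?_
    rcases lt_or_ge i N with hi | hi
    · exact le_max_of_le_left (hr i hi)
    · exact le_max_of_le_right (hN i hi).le
  have h2 : max r (‖z‖ / 2) < ‖z‖ := max_lt hrz (by linarith)
  exact absurd (this.trans_lt h2) (lt_irrefl _)

theorem norm_apply_le_norm_czero (z : C₀(ℕ, 𝕜)) (i : ℕ) : ‖z i‖ ≤ ‖z‖ :=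
  z.toBCF.norm_coe_le_norm i

theorem norm_czero_le {z : C₀(ℕ, 𝕜)} {M : ℝ} (hM : 0 ≤ M) (h : ∀ i, ‖z i‖ ≤ M) : ‖z‖ ≤ M :=
  (BoundedContinuousFunction.norm_le (f := z.toBCF) hM).2 h

/-- A null sequence as an element of `c₀`. -/
def czeroMk (u : ℕ → 𝕜) (hu : Tendsto u atTop (𝓝 0)) : C₀(ℕ, 𝕜) where
  toFun := u
  continuous_toFun := continuous_of_discreteTopology
  zero_at_infty' := by rwa [cocompact_eq_cofinite, Nat.cofinite_eq_atTop]

@[simp]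
theorem czeroMk_apply (u : ℕ → 𝕜) (hu : Tendsto u atTop (𝓝 0)) (i : ℕ) : czeroMk u hu i = u i :=
  rfl

theorem exists_ne_zero_vanishing (κ : E →ₗ[𝕜] (ℕ → 𝕜)) (W : Submodule 𝕜 E) (A : Finset ℕ)
    (hA : (A.card : Cardinal) < Module.rank 𝕜 W) : ∃ y ∈ W, y ≠ 0 ∧ ∀ i ∈ A, κ y i = 0 := by
  let f : W →ₗ[𝕜] (A → 𝕜) := LinearMap.funLeft 𝕜 𝕜 (fun i : A => (i : ℕ)) ∘ₗ κ ∘ₗ W.subtype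
  have hf : ¬ Function.Injective f := by
    intro hinj
    have h1 := LinearMap.lift_rank_le_of_injective f hinj
    have h2 := Cardinal.lift_lt.2 hA
    have h3 := h2.trans_le h1
    simp at h3
  rw [← LinearMap.ker_eq_bot, Submodule.eq_bot_iff] at hf
  push Not at hf
  obtain ⟨y, hy, hy0⟩ := hf
  refine ⟨y, y.2, by simpa using hy0, fun i hi => ?_⟩
  exact congrFun (LinearMap.mem_ker.1 hy) ⟨i, hi⟩

/-- Every subspace of dimension at least `n` contains a vector whose largest modulus, normalized to
be `1`, is attained at `n` or more coordinates. -/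
theorem SolidBasis.exists_flat {κ : E →ₗ[𝕜] (ℕ → 𝕜)} {e : ℕ → E} (h : SolidBasis κ e)
    (ht : ∀ x, Tendsto (fun n => trunc κ e n x) atTop (𝓝 x)) (W : Submodule 𝕜 E) (n : ℕ)
    (hn : (n : Cardinal) ≤ Module.rank 𝕜 W) :
    ∃ x ∈ W, ∃ A : Finset ℕ, A.card = n ∧ (∀ i, ‖κ x i‖ ≤ 1) ∧ ∀ i ∈ A, ‖κ x i‖ = 1 := by
  induction n with
  | zero => exact ⟨0, W.zero_mem, ∅, rfl, by simp, by simp⟩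
  | succ n ih =>
    obtain ⟨x, hxW, A, hA, hx1, hxA⟩ := ih (le_trans (by exact_mod_cast n.le_succ) hn)
    by_cases hex : ∃ i ∉ A, ‖κ x i‖ = 1
    · obtain ⟨i, hiA, hi⟩ := hex
      exact ⟨x, hxW, insert i A, by rw [card_insert_of_notMem hiA, hA], hx1, by
        simpa [hi] using hxA⟩
    push Not at hex
    obtain ⟨y, hyW, hy0, hyA⟩ := exists_ne_zero_vanishing κ W A
      (lt_of_lt_of_le (by rw [hA]; exact_mod_cast n.lt_succ_self) hn)
    let J : E →ₗ[𝕜] C₀(ℕ, 𝕜) :=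
      { toFun := fun z => czeroMk (κ z) (h.tendsto_coord ht z)
        map_add' := fun a b => by ext i; simp
        map_smul' := fun c a => by ext i; simp }
    have hJ : ∀ z i, J z i = κ z i := fun _ _ => rfl
    set x' := x - ∑ i ∈ A, κ x i • e i with hx'
    have hx'c : ∀ k, κ x' k = if k ∈ A then 0 else κ x k := fun k => by
      rw [hx', map_sub, Pi.sub_apply, h.coord_sum]
      split_ifs <;> simp
    let g : ℝ → ℝ := fun t => ‖J x' + (t : 𝕜) • J y‖
    have hg : Continuous g := by fun_prop
    have hg0 : g 0 < 1 := by
      have hg0' : g 0 = ‖J x'‖ := by simp [g]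
      rw [hg0']
      rcases (norm_nonneg (J x')).eq_or_lt with h0 | h0
      · rw [← h0]; exact one_pos
      · obtain ⟨i, hi⟩ := exists_norm_apply_eq_norm _ h0
        rw [← hi, hJ, hx'c]
        split_ifs with hiA
        · simp
        · exact lt_of_le_of_ne (hx1 i) (hex i hiA)
    have hJy : 0 < ‖J y‖ := by
      rw [norm_pos_iff]
      intro h0
      refine hy0 (h.ext fun i => ?_)
      rw [← hJ, h0]
      simp
    have hg1 : 1 ≤ g ((1 + ‖J x'‖) / ‖J y‖) := by
      have h1 : ‖J y‖ * ((1 + ‖J x'‖) / ‖J y‖) = 1 + ‖J x'‖ := by field_simp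
      have h2 : ‖(((1 + ‖J x'‖) / ‖J y‖ : ℝ) : 𝕜) • J y‖ = 1 + ‖J x'‖ := by
        rw [norm_smul, RCLike.norm_ofReal, abs_of_nonneg (by positivity), mul_comm, h1]
      have h3 := norm_sub_norm_le ((((1 + ‖J x'‖) / ‖J y‖ : ℝ) : 𝕜) • J y) (-(J x'))
      rw [norm_neg, sub_neg_eq_add, h2, add_comm (_ • J y)] at h3
      show 1 ≤ ‖_‖
      linarith
    obtain ⟨t, -, ht1⟩ := intermediate_value_Icc (a := 0) (b := (1 + ‖J x'‖) / ‖J y‖)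
      (by positivity) hg.continuousOn ⟨hg0.le, hg1⟩
    have hval : ∀ k, (J x' + (t : 𝕜) • J y) k = if k ∈ A then 0 else κ (x + (t : 𝕜) • y) k := by
      intro k
      rw [ZeroAtInftyContinuousMap.add_apply, ZeroAtInftyContinuousMap.smul_apply, hJ, hJ, hx'c]
      split_ifs with hk
      · simp [hyA k hk]
      · rw [map_add, map_smul]; rfl
    have hvalA : ∀ k ∈ A, κ (x + (t : 𝕜) • y) k = κ x k := fun k hk => by simp [hyA k hk]
    obtain ⟨i, hi⟩ := exists_norm_apply_eq_norm (J x' + (t : 𝕜) • J y)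
      (by change 0 < g t; rw [ht1]; exact one_pos)
    have hnorm : ‖J x' + (t : 𝕜) • J y‖ = 1 := ht1
    rw [hnorm, hval] at hi
    have hiA : i ∉ A := by
      intro hiA
      rw [if_pos hiA] at hi
      simp at hi
    rw [if_neg hiA] at hi
    refine ⟨x + (t : 𝕜) • y, W.add_mem hxW (W.smul_mem _ hyW), insert i A,
      by rw [card_insert_of_notMem hiA, hA], fun k => ?_, fun k hk => ?_⟩
    · by_cases hk : k ∈ A
      · rw [hvalA k hk]; exact hx1 k
      · have := norm_apply_le_norm_czero (J x' + (t : 𝕜) • J y) k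
        rwa [hval, if_neg hk, hnorm] at this
    · rcases mem_insert.1 hk with rfl | hk
      · exact hi
      · rw [hvalA k hk]; exact hxA k hk

/-- If vectors with many coordinates of modulus at least `1` have large norm, then subspaces of
large dimension contain unit vectors with small coordinates. -/
theorem SolidBasis.exists_unit_small_coord {κ : E →ₗ[𝕜] (ℕ → 𝕜)} {e : ℕ → E}
    (h : SolidBasis κ e) (ht : ∀ x, Tendsto (fun n => trunc κ e n x) atTop (𝓝 x))
    (hflat : ∀ M : ℝ, ∃ n : ℕ, ∀ (A : Finset ℕ) (x : E), A.card = n → (∀ i ∈ A, ‖κ x i‖ = 1) →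
      M ≤ ‖x‖) {η : ℝ} (hη : 0 < η) :
    ∃ n : ℕ, ∀ W : Submodule 𝕜 E, (n : Cardinal) ≤ Module.rank 𝕜 W →
      ∃ x ∈ W, ‖x‖ = 1 ∧ ∀ i, ‖κ x i‖ ≤ η := by
  obtain ⟨n, hn⟩ := hflat η⁻¹
  refine ⟨n, fun W hW => ?_⟩
  obtain ⟨x, hxW, A, hA, hx1, hxA⟩ := h.exists_flat ht W n hW
  have hx := hn A x hA hxA
  have hpos : 0 < ‖x‖ := lt_of_lt_of_le (inv_pos.2 hη) hx
  refine ⟨((‖x‖⁻¹ : ℝ) : 𝕜) • x, W.smul_mem _ hxW, ?_, fun i => ?_⟩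
  · rw [norm_smul, RCLike.norm_ofReal, abs_of_pos (inv_pos.2 hpos), inv_mul_cancel₀ hpos.ne']
  · rw [map_smul, Pi.smul_apply, norm_smul, RCLike.norm_ofReal, abs_of_pos (inv_pos.2 hpos)]
    have h1 : ‖x‖⁻¹ ≤ η := inv_le_of_inv_le₀ hη hx
    calc ‖x‖⁻¹ * ‖κ x i‖ ≤ ‖x‖⁻¹ * 1 := by gcongr; exact hx1 i
      _ ≤ η := by rwa [mul_one]

/-! ### Spaces with a spreading, weakly null unconditional basis -/

section Spreading

variable {D : Type*} [NormedAddCommGroup D] [NormedSpace 𝕜 D]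

/-- A normed space of scalar sequences in which the unit vectors form an unconditional basis that
dominates its subsequences and is weakly null. -/
structure SpreadingBasis (κ : D →ₗ[𝕜] (ℕ → 𝕜)) (δ : ℕ → D) : Prop where
  coord_basis : ∀ n, κ (δ n) = Pi.single n 1
  norm_coord_le : ∀ x n, ‖κ x n‖ ≤ ‖x‖
  hasSum : ∀ d, HasSum (fun j => κ d j • δ j) d
  spreading : ∀ φ : ℕ → ℕ, StrictMono φ → ∀ (s : Finset ℕ) (c : ℕ → 𝕜),
    ‖∑ j ∈ s, c j • δ (φ j)‖ ≤ ‖∑ j ∈ s, c j • δ j‖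
  tendsto_dual : ∀ g : D →L[𝕜] 𝕜, Tendsto (fun j => g (δ j)) atTop (𝓝 0)

namespace SpreadingBasis

variable {κ : D →ₗ[𝕜] (ℕ → 𝕜)} {δ : ℕ → D}

theorem ext (h : SpreadingBasis κ δ) {x y : D} (hxy : ∀ j, κ x j = κ y j) : x = y := by
  refine (h.hasSum x).unique ?_
  simp_rw [hxy]
  exact h.hasSum y

theorem norm_coeff_le (h : SpreadingBasis κ δ) (s : Finset ℕ) (c : ℕ → 𝕜) {j : ℕ} (hj : j ∈ s) :
    ‖c j‖ ≤ ‖∑ i ∈ s, c i • δ i‖ := by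
  have h1 := h.norm_coord_le (∑ i ∈ s, c i • δ i) j
  have h2 : κ (∑ i ∈ s, c i • δ i) j = c j := by
    simp only [map_sum, map_smul, h.coord_basis, Finset.sum_apply, Pi.smul_apply, smul_eq_mul,
      Pi.single_apply, mul_ite, mul_one, mul_zero]
    simp [hj]
  rwa [h2] at h1

/-- A sequence dominated by the basis is its image under a bounded operator. -/
theorem exists_clm_of_dominated (h : SpreadingBasis κ δ) [CompleteSpace D]
    [CompleteSpace E] (x : ℕ → E) {C : ℝ}
    (hC0 : 0 ≤ C) (hC : ∀ (s : Finset ℕ) (c : ℕ → 𝕜),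
      ‖∑ j ∈ s, c j • x j‖ ≤ C * ‖∑ j ∈ s, c j • δ j‖) :
    ∃ U : D →L[𝕜] E, ∀ j, U (δ j) = x j := by
  have hsum : ∀ d, Summable (fun j => κ d j • x j) := by
    intro d
    rw [summable_iff_vanishing_norm]
    intro ε hε
    obtain ⟨s, hs⟩ := summable_iff_vanishing_norm.1 (h.hasSum d).summable (ε / (C + 1))
      (by positivity)
    refine ⟨s, fun t hts => ?_⟩
    have h1 := hs t hts
    rw [lt_div_iff₀ (by positivity)] at h1
    have h2 := hC t (κ d)
    nlinarith [norm_nonneg (∑ j ∈ t, κ d j • δ j)]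
  let L : D →ₗ[𝕜] E :=
    { toFun := fun d => ∑' j, κ d j • x j
      map_add' := fun a b => by
        simp only [map_add, Pi.add_apply, add_smul]
        exact (hsum a).tsum_add (hsum b)
      map_smul' := fun c a => by
        simp only [map_smul, Pi.smul_apply, smul_eq_mul, mul_smul, RingHom.id_apply]
        exact (hsum a).tsum_const_smul c }
  have hL : ∀ d, ‖L d‖ ≤ C * ‖d‖ := fun d =>
    le_of_tendsto_of_tendsto' (hsum d).hasSum.norm ((h.hasSum d).norm.const_mul C)
      fun s => hC s (κ d)
  refine ⟨L.mkContinuous C hL, fun j => ?_⟩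
  change ∑' i, κ (δ j) i • x i = x j
  rw [tsum_eq_single j fun i hi => by simp [h.coord_basis, hi]]
  simp [h.coord_basis]

theorem opNorm_le_of_basis (h : SpreadingBasis κ δ) (A : D →L[𝕜] E) {a : ℕ → ℝ} {r : ℝ}
    (ha : HasSum a r) (hA : ∀ k, ‖A (δ k)‖ ≤ a k) : ‖A‖ ≤ r := by
  have ha0 : ∀ k, 0 ≤ a k := fun k => (norm_nonneg _).trans (hA k)
  refine A.opNorm_le_bound (ha.nonneg ha0) fun d => ?_
  have h1 : HasSum (fun j => κ d j • A (δ j)) (A d) := by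
    simpa using A.hasSum (h.hasSum d)
  have h2 := ha.mul_right ‖d‖
  refine le_of_tendsto_of_tendsto' h1.norm h2 fun s => ?_
  refine (norm_sum_le _ _).trans (Finset.sum_le_sum fun j _ => ?_)
  rw [norm_smul, mul_comm]
  exact mul_le_mul (hA j) (h.norm_coord_le d j) (norm_nonneg _) (ha0 j)

/-- An operator moving the basis vectors only slightly is left invertible. -/
theorem exists_left_inverse (h : SpreadingBasis κ δ) [CompleteSpace D] (S : D →L[𝕜] D)
    (hS : ∀ k, ‖S (δ k) - δ k‖ ≤ 1 / 4 * (1 / 2) ^ k) :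
    ∃ R : D →L[𝕜] D, R ∘L S = ContinuousLinearMap.id 𝕜 D := by
  have h1 : ‖1 - S‖ ≤ 1 / 4 * 2 := by
    refine h.opNorm_le_of_basis _ (hasSum_geometric_two.mul_left _) fun k => ?_
    rw [← norm_neg]
    simpa using hS k
  have h2 : IsUnit S := by
    have := isUnit_one_sub_of_norm_lt_one (x := 1 - S) (by linarith)
    rwa [sub_sub_cancel] at this
  obtain ⟨R, hR⟩ := h2.exists_left_inv
  exact ⟨R, hR⟩

end SpreadingBasis

end Spreading

/-! ### The factorization theorem -/

theorem exists_strictMono_of_step {α : Type*} (R : ℕ → ℕ → α → ℕ → Prop)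
    (h : ∀ j m, ∃ a n, m < n ∧ R j m a n) :
    ∃ (a : ℕ → α) (b : ℕ → ℕ), StrictMono b ∧ ∀ j, R j (b j) (a j) (b (j + 1)) := by
  choose f g hlt hR using h
  let b : ℕ → ℕ := fun n => Nat.rec 0 (fun j m => g j m) n
  have hb : ∀ j, b (j + 1) = g j (b j) := fun _ => rfl
  refine ⟨fun j => f j (b j), b, strictMono_nat_of_lt_succ fun j => ?_, fun j => ?_⟩
  · rw [hb]; exact hlt _ _
  · rw [hb]; exact hR _ _

section Factorization

variable {D : Type*} [NormedAddCommGroup D] [NormedSpace 𝕜 D]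

/-- Normalized blocks with rapidly decreasing coordinates are dominated by the basis `δ`. -/
def BlocksDominated (κ : E →ₗ[𝕜] (ℕ → 𝕜)) (δ : ℕ → D) (C : ℝ) : Prop :=
  ∀ (w : ℕ → E) (b : ℕ → ℕ), StrictMono b → (∀ j, ‖w j‖ ≤ 1) →
    (∀ j i, κ (w j) i ≠ 0 → b j ≤ i ∧ i < b (j + 1)) →
    (∀ j i, ‖κ (w j) i‖ * ((b j : ℝ) + 1) ^ 2 ≤ (1 / 2) ^ j) →
    ∀ (s : Finset ℕ) (c : ℕ → 𝕜), ‖∑ j ∈ s, c j • w j‖ ≤ C * ‖∑ j ∈ s, c j • δ j‖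

/-- Scalars controlled by the norms of successive blocks of `x` are the coordinates of an element
of the second space, depending boundedly on `x`. -/
def BlocksDominate (κ : E →ₗ[𝕜] (ℕ → 𝕜)) (e : ℕ → E) (ℓ : D →ₗ[𝕜] (ℕ → 𝕜)) : Prop :=
  ∀ (b : ℕ → ℕ), StrictMono b → ∀ (C : ℝ), 0 ≤ C → ∀ g : ℕ → E →ₗ[𝕜] 𝕜,
    (∀ j x, ‖g j x‖ ≤ C * ‖trunc κ e (b (j + 1)) x - trunc κ e (b j) x‖) →
    ∃ V : E →L[𝕜] D, (∀ x, ‖V x‖ ≤ C * ‖x‖) ∧ ∀ x j, ℓ (V x) j = g j x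

theorem SolidBasis.dominated_of_small_coord {κ : E →ₗ[𝕜] (ℕ → 𝕜)} {e : ℕ → E}
    {ℓ : D →ₗ[𝕜] (ℕ → 𝕜)} {δ : ℕ → D} (h : SolidBasis κ e) (he : ∀ n, ‖e n‖ ≤ 1)
    (hδ : SpreadingBasis ℓ δ) {C : ℝ} (hC : BlocksDominated κ δ C) {x : ℕ → E} {b : ℕ → ℕ}
    (hb : StrictMono b) (hx1 : ∀ j, ‖x j‖ ≤ 1)
    (hxi : ∀ j i, ‖κ (x j) i‖ * ((b j : ℝ) + 1) ^ 2 ≤ (1 / 2) ^ j)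
    (hxt : ∀ j, ‖x j - trunc κ e (b (j + 1)) (x j)‖ ≤ (1 / 2) ^ j) (s : Finset ℕ) (c : ℕ → 𝕜) :
    ‖∑ j ∈ s, c j • x j‖ ≤ (C + 4) * ‖∑ j ∈ s, c j • δ j‖ := by
  set w : ℕ → E := fun j => trunc κ e (b (j + 1)) (x j) - trunc κ e (b j) (x j) with hw
  have hwc : ∀ j i, κ (w j) i = if b j ≤ i ∧ i < b (j + 1) then κ (x j) i else 0 := by
    intro j i
    exact h.coord_trunc_sub_trunc (hb (Nat.lt_succ_self j)).le (x j) i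
  have hwle : ‖∑ j ∈ s, c j • w j‖ ≤ C * ‖∑ j ∈ s, c j • δ j‖ := by
    refine hC w b hb (fun j => (h.norm_trunc_sub_trunc_le _ _ _).trans (hx1 j)) ?_ ?_ s c
    · intro j i hne
      by_contra hcon
      exact hne (by rw [hwc, if_neg hcon])
    · intro j i
      rw [hwc]
      split_ifs
      · exact hxi j i
      · simp
  have hhead : ∀ j, ‖trunc κ e (b j) (x j)‖ ≤ (1 / 2) ^ j := by
    intro j
    have hpos : (0 : ℝ) < ((b j : ℝ) + 1) ^ 2 := by positivity
    refine (norm_trunc_le_mul he (b j) fun i => (le_div_iff₀ hpos).2 (hxi j i)).trans ?_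
    rw [mul_div_assoc', div_le_iff₀ hpos, mul_comm]
    gcongr
    nlinarith [(Nat.cast_nonneg (b j) : (0 : ℝ) ≤ b j)]
  have hdiff : ∀ j, ‖x j - w j‖ ≤ 2 * (1 / 2) ^ j := by
    intro j
    have : x j - w j = (x j - trunc κ e (b (j + 1)) (x j)) + trunc κ e (b j) (x j) := by
      simp only [hw]; abel
    rw [this, two_mul]
    exact (norm_add_le _ _).trans (add_le_add (hxt j) (hhead j))
  have hsplit : ∑ j ∈ s, c j • x j = ∑ j ∈ s, c j • w j + ∑ j ∈ s, c j • (x j - w j) := by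
    rw [← Finset.sum_add_distrib]
    exact Finset.sum_congr rfl fun j _ => by rw [← smul_add, add_sub_cancel]
  have hrest : ‖∑ j ∈ s, c j • (x j - w j)‖ ≤ 4 * ‖∑ j ∈ s, c j • δ j‖ := by
    set K := ‖∑ j ∈ s, c j • δ j‖ with hK
    have hK0 : 0 ≤ K := norm_nonneg _
    calc ‖∑ j ∈ s, c j • (x j - w j)‖ ≤ ∑ j ∈ s, K * (2 * (1 / 2) ^ j) := by
          refine (norm_sum_le _ _).trans (Finset.sum_le_sum fun j hj => ?_)
          rw [norm_smul]
          exact mul_le_mul (hδ.norm_coeff_le s c hj) (hdiff j) (norm_nonneg _) hK0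
      _ = 2 * K * ∑ j ∈ s, (1 / 2 : ℝ) ^ j := by
          rw [Finset.mul_sum]
          exact Finset.sum_congr rfl fun j _ => by ring
      _ ≤ 2 * K * 2 := by
          gcongr
          exact sum_le_hasSum s (fun j _ => by positivity) hasSum_geometric_two
      _ = 4 * K := by ring
  rw [hsplit]
  refine (norm_add_le _ _).trans ?_
  linarith

/-- An operator that is not finitely strictly singular fixes a sequence of unit vectors dominated
by the basis `δ`. -/
theorem SolidBasis.exists_clm_of_not_fss {F : Type*} [NormedAddCommGroup F] [NormedSpace 𝕜 F]
    [CompleteSpace D] [CompleteSpace E] {κ : E →ₗ[𝕜] (ℕ → 𝕜)} {e : ℕ → E}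
    {ℓ : D →ₗ[𝕜] (ℕ → 𝕜)} {δ : ℕ → D} (h : SolidBasis κ e) (he : ∀ n, ‖e n‖ ≤ 1)
    (ht : ∀ x, Tendsto (fun n => trunc κ e n x) atTop (𝓝 x))
    (hflat : ∀ M : ℝ, ∃ n : ℕ, ∀ (A : Finset ℕ) (x : E), A.card = n → (∀ i ∈ A, ‖κ x i‖ = 1) →
      M ≤ ‖x‖)
    (hδ : SpreadingBasis ℓ δ) {C : ℝ} (hC0 : 0 ≤ C) (hC : BlocksDominated κ δ C)
    (T : E →L[𝕜] F) (hT : ¬ IsFinitelyStrictlySingular T) :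
    ∃ ε : ℝ, 0 < ε ∧ ∃ U : D →L[𝕜] E, ∀ j, ε ≤ ‖T (U (δ j))‖ := by
  unfold IsFinitelyStrictlySingular at hT
  push Not at hT
  obtain ⟨ε, hε, hT⟩ := hT
  have hX : ∀ η : ℝ, 0 < η → ∃ x : E, ‖x‖ = 1 ∧ (∀ i, ‖κ x i‖ ≤ η) ∧ ε ≤ ‖T x‖ := by
    intro η hη
    obtain ⟨n, hn⟩ := h.exists_unit_small_coord ht hflat hη
    obtain ⟨W, hW, hWT⟩ := hT n
    obtain ⟨x, hxW, hx1, hxi⟩ := hn W hW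
    exact ⟨x, hx1, hxi, (hWT x hxW hx1).le⟩
  obtain ⟨x, b, hb, hxb⟩ := exists_strictMono_of_step
    (fun j m (x : E) n => ‖x‖ = 1 ∧ ε ≤ ‖T x‖ ∧
      (∀ i, ‖κ x i‖ * ((m : ℝ) + 1) ^ 2 ≤ (1 / 2) ^ j) ∧
      ‖x - trunc κ e n x‖ ≤ (1 / 2) ^ j) (by
    intro j m
    have hpos : (0 : ℝ) < ((m : ℝ) + 1) ^ 2 := by positivity
    obtain ⟨x, hx1, hxi, hxT⟩ := hX ((1 / 2) ^ j / ((m : ℝ) + 1) ^ 2) (by positivity)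
    have h1 : Tendsto (fun n => ‖x - trunc κ e n x‖) atTop (𝓝 0) := by
      simpa using ((tendsto_const_nhds (x := x)).sub (ht x)).norm
    obtain ⟨n, hn, hmn⟩ := ((h1.eventually (gt_mem_nhds (show (0 : ℝ) < (1 / 2) ^ j by
      positivity))).and (eventually_gt_atTop m)).exists
    exact ⟨x, n, hmn, hx1, hxT, fun i => (le_div_iff₀ hpos).1 (hxi i), hn.le⟩)
  obtain ⟨U, hU⟩ := hδ.exists_clm_of_dominated x (add_nonneg hC0 zero_le_four)
    (h.dominated_of_small_coord he hδ hC hb (fun j => (hxb j).1.le) (fun j => (hxb j).2.2.1)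
      (fun j => (hxb j).2.2.2))
  exact ⟨ε, hε, U, fun j => by rw [hU]; exact (hxb j).2.1⟩

/-- If the images of the basis vectors under `S : D → E` stay away from zero, then the identity of
`D` factors through the restriction of `S` to the span of a subsequence. -/
theorem SolidBasis.exists_factorization [CompleteSpace D] {κ : E →ₗ[𝕜] (ℕ → 𝕜)} {e : ℕ → E}
    {ℓ : D →ₗ[𝕜] (ℕ → 𝕜)} {δ : ℕ → D} (h : SolidBasis κ e)
    (ht : ∀ x, Tendsto (fun n => trunc κ e n x) atTop (𝓝 x))
    (hδ : SpreadingBasis ℓ δ) (hV : BlocksDominate κ e ℓ) (S : D →L[𝕜] E) {ε : ℝ} (hε : 0 < ε)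
    (hS : ∀ j, ε ≤ ‖S (δ j)‖) :
    ∃ (Φ : D →L[𝕜] D) (V : E →L[𝕜] D), V ∘L S ∘L Φ = ContinuousLinearMap.id 𝕜 D := by
  have hhead : ∀ m, Tendsto (fun k => ‖trunc κ e m (S (δ k))‖) atTop (𝓝 0) := by
    intro m
    have hi : ∀ i, Tendsto (fun k => κ (S (δ k)) i) atTop (𝓝 0) := by
      intro i
      let f : E →L[𝕜] 𝕜 := (LinearMap.proj i ∘ₗ κ).mkContinuous 1 fun x => by
        simpa using h.norm_coord_le x i
      exact hδ.tendsto_dual (f ∘L S)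
    have : Tendsto (fun k => ∑ i ∈ range m, κ (S (δ k)) i • e i) atTop
        (𝓝 (∑ i ∈ range m, (0 : 𝕜) • e i)) :=
      tendsto_finsetSum _ fun i _ => (hi i).smul_const (e i)
    simpa [trunc_apply] using this.norm
  obtain ⟨k, b, hb, hkb⟩ := exists_strictMono_of_step
    (fun j m (k : ℕ) n => m ≤ k ∧ k < n ∧
      ‖S (δ k) - (trunc κ e n (S (δ k)) - trunc κ e m (S (δ k)))‖ ≤ ε / 8 * (1 / 2) ^ j) (by
    intro j m
    have hpos : (0 : ℝ) < ε / 16 * (1 / 2) ^ j := by positivity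
    obtain ⟨k, hk, hmk⟩ := (((hhead m).eventually (gt_mem_nhds hpos)).and
      (eventually_ge_atTop m)).exists
    have h1 : Tendsto (fun n => ‖S (δ k) - trunc κ e n (S (δ k))‖) atTop (𝓝 0) := by
      simpa using ((tendsto_const_nhds (x := S (δ k))).sub (ht (S (δ k)))).norm
    obtain ⟨n, hn, hkn⟩ := ((h1.eventually (gt_mem_nhds hpos)).and
      (eventually_gt_atTop k)).exists
    refine ⟨k, n, by omega, hmk, hkn, ?_⟩
    have h2 := norm_add_le (S (δ k) - trunc κ e n (S (δ k))) (trunc κ e m (S (δ k)))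
    rw [sub_add] at h2
    linarith)
  have hkmono : StrictMono k := strictMono_nat_of_lt_succ fun j =>
    (hkb j).2.1.trans_le (hkb (j + 1)).1
  obtain ⟨Φ, hΦ⟩ := hδ.exists_clm_of_dominated (fun j => δ (k j)) zero_le_one (fun s c => by
    rw [one_mul]; exact hδ.spreading k hkmono s c)
  set y : ℕ → E := fun j => S (δ (k j)) with hy
  let P : ℕ → E →ₗ[𝕜] E := fun j => trunc κ e (b (j + 1)) - trunc κ e (b j)
  have hPapp : ∀ j x, P j x = trunc κ e (b (j + 1)) x - trunc κ e (b j) x := fun _ _ => rfl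
  have hPP : ∀ i j x, P i (P j x) = if i = j then P j x else 0 := by
    intro i j x
    refine h.ext fun n => ?_
    have hi := hb (Nat.lt_succ_self i)
    have hj := hb (Nat.lt_succ_self j)
    simp only [Nat.succ_eq_add_one] at hi hj
    have hcoord : ∀ l z, κ (P l z) n = if b l ≤ n ∧ n < b (l + 1) then κ z n else 0 := by
      intro l z
      exact h.coord_trunc_sub_trunc (hb (Nat.lt_succ_self l)).le z n
    split_ifs with hij
    · subst hij
      simp only [hcoord]
      split_ifs <;> rfl
    · rw [hcoord, hcoord]
      have hdis : ¬ ((b i ≤ n ∧ n < b (i + 1)) ∧ (b j ≤ n ∧ n < b (j + 1))) := by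
        rintro ⟨h1, h2⟩
        rcases lt_or_gt_of_ne hij with hlt | hlt
        · have := hb.monotone (Nat.succ_le_of_lt hlt)
          simp only [Nat.succ_eq_add_one] at this
          omega
        · have := hb.monotone (Nat.succ_le_of_lt hlt)
          simp only [Nat.succ_eq_add_one] at this
          omega
      rw [map_zero, Pi.zero_apply]
      split_ifs <;> tauto
  have hyP : ∀ j, ‖y j - P j (y j)‖ ≤ ε / 8 * (1 / 2) ^ j := fun j => (hkb j).2.2
  have hz : ∀ j, ε / 2 ≤ ‖P j (y j)‖ := by
    intro j
    have h1 := norm_sub_norm_le (y j) (P j (y j))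
    have h2 : (1 / 2 : ℝ) ^ j ≤ 1 := pow_le_one₀ (by norm_num) (by norm_num)
    have h3 := hyP j
    have h4 := hS (k j)
    change ε ≤ ‖y j‖ at h4
    nlinarith
  have hz0 : ∀ j, 0 < ‖P j (y j)‖ := fun j => lt_of_lt_of_le (half_pos hε) (hz j)
  choose f hf1 hf using fun j => exists_dual_vector'' 𝕜 (P j (y j))
  obtain ⟨V, hVle, hVc⟩ := hV b hb (2 / ε) (by positivity)
    (fun j => ((‖P j (y j)‖⁻¹ : ℝ) : 𝕜) • ((f j).toLinearMap ∘ₗ P j)) (by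
    intro j x
    rw [← hPapp]
    have h1 : ‖f j (P j x)‖ ≤ ‖P j x‖ := by
      simpa using (f j).le_of_opNorm_le (hf1 j) (P j x)
    have h2 : ‖P j (y j)‖⁻¹ ≤ 2 / ε := by
      rw [← inv_div]
      exact inv_anti₀ (half_pos hε) (hz j)
    rw [LinearMap.smul_apply, norm_smul, RCLike.norm_ofReal, abs_of_pos (inv_pos.2 (hz0 j))]
    exact mul_le_mul h2 h1 (norm_nonneg _) (by positivity))
  have hVz : ∀ j, V (P j (y j)) = δ j := by
    intro j
    refine hδ.ext fun i => ?_
    rw [hVc, hδ.coord_basis, LinearMap.smul_apply, LinearMap.comp_apply, hPP]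
    by_cases hij : i = j
    · subst hij
      have h1 := hf i
      rw [if_pos rfl, ContinuousLinearMap.coe_coe, h1, smul_eq_mul, ← RCLike.ofReal_mul,
        inv_mul_cancel₀ (hz0 i).ne']
      simp
    · simp [hij]
  obtain ⟨R, hR⟩ := hδ.exists_left_inverse (V ∘L S ∘L Φ) (by
    intro j
    have h1 : (V ∘L S ∘L Φ) (δ j) - δ j = V (y j - P j (y j)) := by
      rw [map_sub, hVz]
      simp [hΦ, hy]
    rw [h1]
    refine (hVle _).trans ?_
    calc 2 / ε * ‖y j - P j (y j)‖ ≤ 2 / ε * (ε / 8 * (1 / 2) ^ j) := by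
          gcongr
          exact hyP j
      _ = 1 / 4 * (1 / 2) ^ j := by field_simp; norm_num)
  exact ⟨Φ, R ∘L V, hR⟩

theorem SolidBasis.idFactorsThrough_of_not_fss [CompleteSpace D] [CompleteSpace E]
    {κ : E →ₗ[𝕜] (ℕ → 𝕜)} {e : ℕ → E}
    {ℓ : D →ₗ[𝕜] (ℕ → 𝕜)} {δ : ℕ → D} (h : SolidBasis κ e) (he : ∀ n, ‖e n‖ ≤ 1)
    (ht : ∀ x, Tendsto (fun n => trunc κ e n x) atTop (𝓝 x))
    (hflat : ∀ M : ℝ, ∃ n : ℕ, ∀ (A : Finset ℕ) (x : E), A.card = n → (∀ i ∈ A, ‖κ x i‖ = 1) →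
      M ≤ ‖x‖)
    (hδ : SpreadingBasis ℓ δ) {C : ℝ} (hC0 : 0 ≤ C) (hC : BlocksDominated κ δ C)
    (hV : BlocksDominate κ e ℓ) (T : E →L[𝕜] E) (hT : ¬ IsFinitelyStrictlySingular T) :
    IdFactorsThrough D T := by
  obtain ⟨ε, hε, U, hU⟩ := h.exists_clm_of_not_fss he ht hflat hδ hC0 hC T hT
  obtain ⟨Φ, V, hVΦ⟩ := h.exists_factorization ht hδ hV (T ∘L U) hε hU
  exact ⟨U ∘L Φ, V, hVΦ⟩

/-- The four conditions are equivalent once the identity of `D` factors through every operator that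
is not finitely strictly singular. -/
theorem tfae_of_idFactorsThrough {X Y : Type*} [NormedAddCommGroup X] [NormedSpace 𝕜 X]
    [NormedAddCommGroup Y] [NormedSpace 𝕜 Y] (hD : ¬ FiniteDimensional 𝕜 D)
    (T : X →L[𝕜] Y) (hT : ¬ IsFinitelyStrictlySingular T → IdFactorsThrough D T) :
    List.TFAE [IsFinitelyStrictlySingular T, IsStrictlySingular T, ¬ FixesCopyOf D T,
      ¬ IdFactorsThrough D T] := by
  tfae_have 1 → 2 := by
    rintro h W hW ⟨c, hc, hcT⟩
    obtain ⟨n, hn⟩ := h (c / 2) (half_pos hc)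
    have hrank : (n : Cardinal) ≤ Module.rank 𝕜 W :=
      Cardinal.natCast_le_aleph0.trans
        (le_of_not_gt fun hlt => hW (Module.rank_lt_aleph0_iff.1 hlt))
    obtain ⟨x, hx, hx1, hTx⟩ := hn W hrank
    have h1 := hcT ⟨x, hx⟩
    have h2 : c * ‖x‖ ≤ ‖T x‖ := h1
    rw [hx1] at h2
    linarith
  tfae_have 2 → 3 := by
    rintro h ⟨W, ⟨Ψ⟩, hW⟩
    refine h W (fun hfin => hD ?_) hW
    exact Ψ.symm.toLinearEquiv.finiteDimensional
  tfae_have 3 → 4 := by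
    rintro h ⟨U, V, hVTU⟩
    have hid : ∀ d, V (T (U d)) = d := fun d => DFunLike.congr_fun hVTU d
    have hbound : ∀ d, ‖d‖ ≤ ‖V‖ * ‖T (U d)‖ := fun d => by
      simpa [hid] using V.le_opNorm (T (U d))
    let L : D ≃ₗ[𝕜] LinearMap.range U.toLinearMap := LinearEquiv.ofInjective U.toLinearMap
      (Function.LeftInverse.injective (g := fun x => V (T x)) hid)
    have hL : ∀ d, (L d : X) = U d := fun d => rfl
    have hLs : ∀ w, U (L.symm w) = w := fun w => by rw [← hL, L.apply_symm_apply]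
    refine h ⟨LinearMap.range U.toLinearMap, ⟨L.toContinuousLinearEquivOfBounds ‖U‖ (‖V‖ * ‖T‖)
      (fun d => U.le_opNorm d) (fun w => ?_)⟩, (‖U‖ * ‖V‖ + 1)⁻¹, by positivity, fun w => ?_⟩
    · refine (hbound _).trans ?_
      rw [hLs, mul_assoc]
      gcongr
      exact T.le_opNorm _
    · have h1 := hbound (L.symm w)
      rw [hLs] at h1
      have h2 : ‖w‖ ≤ ‖U‖ * ‖L.symm w‖ := by
        have := U.le_opNorm (L.symm w)
        rwa [hLs] at this
      rw [inv_mul_le_iff₀ (by positivity)]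
      change ‖w‖ ≤ (‖U‖ * ‖V‖ + 1) * ‖T w‖
      have h3 : ‖U‖ * ‖L.symm w‖ ≤ ‖U‖ * (‖V‖ * ‖T w‖) := by gcongr
      nlinarith [norm_nonneg (T (w : X))]
  tfae_have 4 → 1 := fun h => by
    by_contra hcon
    exact h (hT hcon)
  tfae_finish

end Factorization

/-! ### The unit vector bases of `ℓ_p` and `c₀` -/

theorem SpreadingBasis.not_finiteDimensional {D : Type*} [NormedAddCommGroup D] [NormedSpace 𝕜 D]
    {κ : D →ₗ[𝕜] (ℕ → 𝕜)} {δ : ℕ → D} (h : SpreadingBasis κ δ) : ¬ FiniteDimensional 𝕜 D := by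
  intro hfin
  have h1 : LinearIndependent 𝕜 (κ ∘ δ) := by
    have h2 : κ ∘ δ = fun n => Pi.single n (1 : 𝕜) := funext h.coord_basis
    rw [h2]
    exact Pi.linearIndependent_single_one ℕ 𝕜
  exact Module.Finite.not_linearIndependent_of_infinite δ (LinearIndependent.of_comp κ h1)

/-- A sequence whose finite combinations with coefficients in the unit disc have norms of order
less than the number of terms is weakly null. -/
theorem tendsto_dual_of_growth {D : Type*} [NormedAddCommGroup D] [NormedSpace 𝕜 D] {δ : ℕ → D}
    {θ : ℝ} (hθ : θ < 1) (hδ : ∀ (s : Finset ℕ) (c : ℕ → 𝕜), (∀ j, ‖c j‖ ≤ 1) →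
      ‖∑ j ∈ s, c j • δ j‖ ≤ (s.card : ℝ) ^ θ) (g : D →L[𝕜] 𝕜) :
    Tendsto (fun j => g (δ j)) atTop (𝓝 0) := by
  rw [Metric.tendsto_nhds]
  intro η hη
  by_contra hcon
  have hinf : Set.Infinite {j | η ≤ ‖g (δ j)‖} := by
    rw [← Nat.frequently_atTop_iff_infinite]
    simpa [Filter.Frequently] using hcon
  have hbound : ∀ n : ℕ, 0 < n → (n : ℝ) ^ (1 - θ) ≤ ‖g‖ / η := by
    intro n hn
    obtain ⟨s, hs, hsc⟩ := hinf.exists_subset_card_eq n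
    let c : ℕ → 𝕜 := fun j => ((‖g (δ j)‖⁻¹ : ℝ) : 𝕜) * (starRingEnd 𝕜) (g (δ j))
    have hc1 : ∀ j, ‖c j‖ ≤ 1 := by
      intro j
      simp only [c, norm_mul, RCLike.norm_ofReal, RCLike.norm_conj, abs_inv, abs_norm]
      exact inv_mul_le_one
    have hcg : ∀ j, c j * g (δ j) = ((‖g (δ j)‖ : ℝ) : 𝕜) := by
      intro j
      simp only [c]
      rw [mul_assoc, RCLike.conj_mul]
      rcases eq_or_ne ‖g (δ j)‖ 0 with h0 | h0
      · simp [h0]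
      · push_cast
        rw [sq, inv_mul_cancel_left₀ (by exact_mod_cast h0)]
    have h1 : g (∑ j ∈ s, c j • δ j) = ((∑ j ∈ s, ‖g (δ j)‖ : ℝ) : 𝕜) := by
      rw [map_sum]
      push_cast
      exact Finset.sum_congr rfl fun j _ => by rw [map_smul, smul_eq_mul, hcg]
    have h2 : (n : ℝ) * η ≤ ∑ j ∈ s, ‖g (δ j)‖ := by
      rw [← hsc, ← nsmul_eq_mul]
      exact Finset.card_nsmul_le_sum _ _ _ fun j hj => hs hj
    have h3 : ∑ j ∈ s, ‖g (δ j)‖ ≤ ‖g‖ * (n : ℝ) ^ θ := by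
      have h4 := g.le_opNorm_of_le (hδ s c hc1)
      rw [h1, RCLike.norm_ofReal, hsc] at h4
      exact (le_abs_self _).trans h4
    have hn' : (0 : ℝ) < n := by exact_mod_cast hn
    rw [Real.rpow_sub hn', Real.rpow_one, div_le_div_iff₀ (Real.rpow_pos_of_pos hn' _) hη]
    exact h2.trans h3
  have htop : Tendsto (fun n : ℕ => (n : ℝ) ^ (1 - θ)) atTop atTop :=
    (tendsto_rpow_atTop (sub_pos.2 hθ)).comp tendsto_natCast_atTop_atTop
  obtain ⟨n, hn, hn0⟩ := ((htop.eventually (eventually_gt_atTop (‖g‖ / η))).and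
    (eventually_gt_atTop 0)).exists
  exact absurd (hbound n hn0) (not_le.2 hn)

section EllP

variable (𝕜) (p : ℝ≥0)

/-- The coordinates of an element of `ℓ_p`. -/
def ellPCoord : EllP 𝕜 p →ₗ[𝕜] (ℕ → 𝕜) where
  toFun d := d
  map_add' _ _ := rfl
  map_smul' _ _ := rfl

/-- The unit vectors of `ℓ_p`. -/
def ellPUnit (n : ℕ) : EllP 𝕜 p := lp.single (p : ℝ≥0∞) n (1 : 𝕜)

variable {𝕜 p}

theorem norm_sum_ellPUnit_rpow [hp : Fact (1 ≤ p)] {φ : ℕ → ℕ} (hφ : Function.Injective φ) (s : Finset ℕ)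
    (c : ℕ → 𝕜) :
    ‖∑ j ∈ s, c j • ellPUnit 𝕜 p (φ j)‖ ^ (p : ℝ) = ∑ j ∈ s, ‖c j‖ ^ (p : ℝ) := by
  have hp0 : 0 < (p : ℝ≥0∞).toReal := by
    rw [ENNReal.coe_toReal]; exact_mod_cast lt_of_lt_of_le one_pos hp.out
  have h1 := lp.norm_sum_single (p := (p : ℝ≥0∞)) (E := fun _ : ℕ => 𝕜) hp0
    (Function.extend φ c 0) (s.map ⟨φ, hφ⟩)
  rw [ENNReal.coe_toReal] at h1
  simp only [Finset.sum_map, Function.Embedding.coeFn_mk, hφ.extend_apply] at h1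
  rw [← h1]
  congr 2
  refine Finset.sum_congr rfl fun j _ => ?_
  rw [ellPUnit, ← lp.single_smul, smul_eq_mul, mul_one]

theorem norm_sum_ellPUnit [hp : Fact (1 ≤ p)] {φ : ℕ → ℕ} (hφ : Function.Injective φ) (s : Finset ℕ)
    (c : ℕ → 𝕜) :
    ‖∑ j ∈ s, c j • ellPUnit 𝕜 p (φ j)‖ = (∑ j ∈ s, ‖c j‖ ^ (p : ℝ)) ^ (1 / (p : ℝ)) := by
  have hp0 : (p : ℝ) ≠ 0 := by exact_mod_cast (lt_of_lt_of_le one_pos hp.out).ne'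
  rw [← norm_sum_ellPUnit_rpow hφ, one_div, Real.rpow_rpow_inv (norm_nonneg _) hp0]

theorem ellP_spreadingBasis [hp : Fact (1 ≤ p)] (hp1 : 1 < p) :
    SpreadingBasis (ellPCoord 𝕜 p) (ellPUnit 𝕜 p) where
  coord_basis n := lp.coeFn_single (E := fun _ : ℕ => 𝕜) (p : ℝ≥0∞) n 1
  norm_coord_le x n := lp.norm_apply_le_norm
    (by exact_mod_cast (lt_of_lt_of_le one_pos hp.out).ne') x n
  hasSum d := by
    have h := lp.hasSum_single (E := fun _ : ℕ => 𝕜) (p := (p : ℝ≥0∞)) ENNReal.coe_ne_top d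
    convert h using 2 with j
    rw [ellPUnit, ← lp.single_smul, smul_eq_mul, mul_one]
    rfl
  spreading φ hφ s c := by
    have h1 := norm_sum_ellPUnit (p := p) hφ.injective s c
    have h2 := norm_sum_ellPUnit (p := p) Function.injective_id s c
    simp only [id] at h2
    rw [h1, h2]
  tendsto_dual := by
    refine tendsto_dual_of_growth (θ := 1 / (p : ℝ)) ?_ fun s c hc => ?_
    · have : (1 : ℝ) < p := by exact_mod_cast hp1
      rw [div_lt_one (by linarith)]
      exact this
    · have h2 := norm_sum_ellPUnit (p := p) Function.injective_id s c
      simp only [id] at h2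
      rw [h2]
      gcongr
      have h3 : ∀ j ∈ s, ‖c j‖ ^ (p : ℝ) ≤ 1 := fun j _ =>
        Real.rpow_le_one (norm_nonneg _) (hc j) p.2
      simpa using Finset.sum_le_sum h3

theorem blocksDominate_ellP [hp : Fact (1 ≤ p)] {κ : E →ₗ[𝕜] (ℕ → 𝕜)} {e : ℕ → E}
    (h : SolidBasis κ e)
    (hlow : ∀ (m n : ℕ) (x : E), m ≤ n → ‖trunc κ e m x‖ ^ (p : ℝ) +
      ‖trunc κ e n x - trunc κ e m x‖ ^ (p : ℝ) ≤ ‖trunc κ e n x‖ ^ (p : ℝ)) :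
    BlocksDominate κ e (ellPCoord 𝕜 p) := by
  intro b hb C hC g hg
  have hp0 : 0 < (p : ℝ) := by exact_mod_cast lt_of_lt_of_le one_pos hp.out
  have hrange : ∀ x n, ∑ j ∈ range n, ‖trunc κ e (b (j + 1)) x - trunc κ e (b j) x‖ ^ (p : ℝ) ≤
      ‖trunc κ e (b n) x‖ ^ (p : ℝ) := by
    intro x n
    induction n with
    | zero => simp; positivity
    | succ n ih =>
      rw [Finset.sum_range_succ]
      exact (add_le_add_left ih _).trans (hlow _ _ x (hb (Nat.lt_succ_self n)).le)
  have hsum : ∀ x (s : Finset ℕ), ∑ j ∈ s, ‖g j x‖ ^ (p : ℝ≥0∞).toReal ≤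
      (C * ‖x‖) ^ (p : ℝ≥0∞).toReal := by
    intro x s
    rw [ENNReal.coe_toReal]
    obtain ⟨n, hn⟩ := s.exists_nat_subset_range
    calc ∑ j ∈ s, ‖g j x‖ ^ (p : ℝ)
        ≤ ∑ j ∈ range n, (C * ‖trunc κ e (b (j + 1)) x - trunc κ e (b j) x‖) ^ (p : ℝ) := by
          refine (Finset.sum_le_sum_of_subset_of_nonneg hn fun _ _ _ => by positivity).trans ?_
          exact Finset.sum_le_sum fun j _ =>
            Real.rpow_le_rpow (norm_nonneg _) (hg j x) hp0.le
      _ = C ^ (p : ℝ) * ∑ j ∈ range n,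
            ‖trunc κ e (b (j + 1)) x - trunc κ e (b j) x‖ ^ (p : ℝ) := by
          rw [Finset.mul_sum]
          exact Finset.sum_congr rfl fun j _ => Real.mul_rpow hC (norm_nonneg _)
      _ ≤ C ^ (p : ℝ) * ‖x‖ ^ (p : ℝ) := by
          gcongr
          refine (hrange x n).trans ?_
          gcongr
          exact h.norm_trunc_le _ _
      _ = (C * ‖x‖) ^ (p : ℝ) := (Real.mul_rpow hC (norm_nonneg _)).symm
  let L : E →ₗ[𝕜] EllP 𝕜 p :=
    { toFun := fun x => ⟨fun j => g j x, memℓp_gen' (hsum x)⟩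
      map_add' := fun x y => by ext j; exact map_add (g j) x y
      map_smul' := fun c x => by ext j; exact map_smul (g j) c x }
  have hL : ∀ x, ‖L x‖ ≤ C * ‖x‖ := fun x =>
    lp.norm_le_of_forall_sum_le (by rwa [ENNReal.coe_toReal]) (by positivity) (hsum x)
  exact ⟨L.mkContinuous C hL, hL, fun x j => rfl⟩

end EllP

section CZero

variable (𝕜)

/-- The coordinates of an element of `c₀`. -/
def czeroCoord : CZero 𝕜 →ₗ[𝕜] (ℕ → 𝕜) where
  toFun d := d
  map_add' _ _ := rfl
  map_smul' _ _ := rfl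

/-- The unit vectors of `c₀`. -/
def czeroUnit (n : ℕ) : CZero 𝕜 :=
  czeroMk (Pi.single n 1) (tendsto_const_nhds.congr' ((eventually_gt_atTop n).mono fun k hk => by
    simp [hk.ne']))

variable {𝕜}

theorem czeroCoord_unit (n : ℕ) : czeroCoord 𝕜 (czeroUnit 𝕜 n) = Pi.single n 1 := rfl

theorem sum_czeroUnit_apply (s : Finset ℕ) (c : ℕ → 𝕜) (k : ℕ) :
    (∑ j ∈ s, c j • czeroUnit 𝕜 j) k = if k ∈ s then c k else 0 := by
  change czeroCoord 𝕜 _ k = _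
  simp only [map_sum, map_smul, czeroCoord_unit, Finset.sum_apply, Pi.smul_apply, smul_eq_mul,
    Pi.single_apply, mul_ite, mul_one, mul_zero]
  simp

theorem norm_coeff_le_czero (s : Finset ℕ) (c : ℕ → 𝕜) {j : ℕ} (hj : j ∈ s) :
    ‖c j‖ ≤ ‖∑ i ∈ s, c i • czeroUnit 𝕜 i‖ := by
  have h := norm_apply_le_norm_czero (∑ i ∈ s, c i • czeroUnit 𝕜 i) j
  rwa [sum_czeroUnit_apply, if_pos hj] at h

theorem czero_spreadingBasis : SpreadingBasis (czeroCoord 𝕜) (czeroUnit 𝕜) where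
  coord_basis := czeroCoord_unit
  norm_coord_le := norm_apply_le_norm_czero
  hasSum d := by
    rw [HasSum, Metric.tendsto_nhds]
    intro ε hε
    have h0 : Tendsto (fun i => ‖d i‖) cofinite (𝓝 0) := by
      have := d.zero_at_infty'
      rw [cocompact_eq_cofinite] at this
      simpa using this.norm
    have hfin := h0.eventually (gt_mem_nhds (half_pos hε))
    rw [eventually_cofinite] at hfin
    filter_upwards [(eventually_ge_atTop hfin.toFinset)] with s hs
    rw [dist_eq_norm]
    refine lt_of_le_of_lt (norm_czero_le (half_pos hε).le fun k => ?_) (half_lt_self hε)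
    have h1 : (∑ j ∈ s, czeroCoord 𝕜 d j • czeroUnit 𝕜 j) k = if k ∈ s then d k else 0 :=
      sum_czeroUnit_apply s (czeroCoord 𝕜 d) k
    rw [ZeroAtInftyContinuousMap.sub_apply, h1]
    split_ifs with hk
    · rw [sub_self, norm_zero]; exact (half_pos hε).le
    · have h2 : k ∉ hfin.toFinset := fun hmem => hk (hs hmem)
      rw [Set.Finite.mem_toFinset] at h2
      simpa using (not_not.1 h2).le
  spreading φ hφ s c := by
    refine norm_czero_le (norm_nonneg _) fun k => ?_
    have h1 : ∑ j ∈ s, c j • czeroUnit 𝕜 (φ j) = ∑ i ∈ s.map ⟨φ, hφ.injective⟩,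
        Function.extend φ c 0 i • czeroUnit 𝕜 i := by
      simp [hφ.injective.extend_apply]
    rw [h1, sum_czeroUnit_apply]
    split_ifs with hk
    · obtain ⟨j, hj, rfl⟩ := Finset.mem_map.1 hk
      simp only [Function.Embedding.coeFn_mk, hφ.injective.extend_apply]
      exact norm_coeff_le_czero s c hj
    · simp
  tendsto_dual := by
    refine tendsto_dual_of_growth (θ := 0) one_pos fun s c hc => ?_
    rw [Real.rpow_zero]
    refine norm_czero_le zero_le_one fun k => ?_
    rw [sum_czeroUnit_apply]
    split_ifs
    · exact hc k
    · simp

theorem blocksDominate_czero {κ : E →ₗ[𝕜] (ℕ → 𝕜)} {e : ℕ → E} (h : SolidBasis κ e)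
    (ht : ∀ x, Tendsto (fun n => trunc κ e n x) atTop (𝓝 x)) :
    BlocksDominate κ e (czeroCoord 𝕜) := by
  intro b hb C hC g hg
  have hlim : ∀ x, Tendsto (fun j => g j x) atTop (𝓝 0) := by
    intro x
    have h1 : Tendsto (fun j => trunc κ e (b j) x) atTop (𝓝 x) := (ht x).comp hb.tendsto_atTop
    have h2 := (((h1.comp (tendsto_add_atTop_nat 1)).sub h1).norm).const_mul C
    rw [sub_self, norm_zero, mul_zero] at h2
    exact squeeze_zero_norm (fun j => hg j x) h2
  let L : E →ₗ[𝕜] CZero 𝕜 :=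
    { toFun := fun x => czeroMk (fun j => g j x) (hlim x)
      map_add' := fun x y => by ext j; simp
      map_smul' := fun c x => by ext j; simp }
  have hL : ∀ x, ‖L x‖ ≤ C * ‖x‖ := fun x => norm_czero_le (by positivity) fun j =>
    (hg j x).trans (mul_le_mul_of_nonneg_left (h.norm_trunc_sub_trunc_le _ _ _) hC)
  exact ⟨L.mkContinuous C hL, hL, fun x j => rfl⟩

end CZero

/-! ### Completeness -/

/-- A space consisting of all sequences on which the suprema of a family of continuous functionals
are finite is complete. -/
theorem completeSpace_of_continuous_family {ι : Type*} (κ : E →ₗ[𝕜] (ℕ → 𝕜))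
    (N : ι → (ℕ → 𝕜) → ℝ) (hN : ∀ i, Continuous (N i))
    (hnorm : ∀ x M, 0 ≤ M → (‖x‖ ≤ M ↔ ∀ i, N i (κ x) ≤ M))
    (hrange : ∀ z M, (∀ i, N i z ≤ M) → ∃ x, κ x = z)
    (hcoord : ∀ x n, ‖κ x n‖ ≤ ‖x‖) : CompleteSpace E := by
  refine Metric.complete_of_cauchySeq_tendsto fun u hu => ?_
  have hlim : ∀ n, ∃ a, Tendsto (fun k => κ (u k) n) atTop (𝓝 a) := by
    intro n
    refine cauchySeq_tendsto_of_complete (Metric.cauchySeq_iff.2 fun ε hε => ?_)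
    obtain ⟨K, hK⟩ := Metric.cauchySeq_iff.1 hu ε hε
    refine ⟨K, fun k hk l hl => lt_of_le_of_lt ?_ (hK k hk l hl)⟩
    rw [dist_eq_norm, dist_eq_norm, ← Pi.sub_apply, ← map_sub]
    exact hcoord _ _
  choose z hz using hlim
  have hzlim : Tendsto (fun k => κ (u k)) atTop (𝓝 z) := tendsto_pi_nhds.2 hz
  have key : ∀ ε, 0 < ε → ∃ K, ∀ k, K ≤ k → ∀ i, N i (κ (u k) - z) ≤ ε := by
    intro ε hε
    obtain ⟨K, hK⟩ := Metric.cauchySeq_iff.1 hu ε hε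
    refine ⟨K, fun k hk i => ?_⟩
    have h1 : Tendsto (fun l => N i (κ (u k) - κ (u l))) atTop (𝓝 (N i (κ (u k) - z))) :=
      ((hN i).tendsto _).comp (tendsto_const_nhds.sub hzlim)
    refine le_of_tendsto h1 ((eventually_ge_atTop K).mono fun l hl => ?_)
    have h2 := (hK k hk l hl).le
    rw [dist_eq_norm, hnorm _ _ hε.le] at h2
    simpa using h2 i
  obtain ⟨K, hK⟩ := key 1 one_pos
  obtain ⟨v, hv⟩ := hrange _ _ (hK K le_rfl)
  have hx : κ (u K - v) = z := by rw [map_sub, hv, sub_sub_cancel]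
  refine ⟨u K - v, Metric.tendsto_atTop.2 fun ε hε => ?_⟩
  obtain ⟨L, hL⟩ := key (ε / 2) (half_pos hε)
  refine ⟨L, fun k hk => lt_of_le_of_lt ?_ (half_lt_self hε)⟩
  rw [dist_eq_norm, hnorm _ _ (half_pos hε).le]
  intro i
  rw [map_sub, hx]
  exact hL k hk i

/-! ### Schreier sets relative to successive intervals -/

theorem IsSchreier.subset {F G : Finset ℕ} (hG : IsSchreier G) (h : F ⊆ G) : IsSchreier F :=
  fun n hn => (card_le_card h).trans (hG n (h hn))

theorem SetLT.subset {F G F' G' : Finset ℕ} (h : SetLT F G) (hF : F' ⊆ F) (hG : G' ⊆ G) :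
    SetLT F' G' :=
  fun a ha b hb => h a (hF ha) b (hG hb)

theorem exists_schreier_subset {A : Finset ℕ} {m : ℕ} (hA : A.card = 2 * m) :
    ∃ G ⊆ A, G.card = m ∧ IsSchreier G := by
  have h1 : m ≤ (A.filter (m ≤ ·)).card := by
    have h2 : A ⊆ range m ∪ A.filter (m ≤ ·) := fun i hi => by
      rw [mem_union, mem_range, mem_filter]
      by_cases h : i < m
      · exact Or.inl h
      · exact Or.inr ⟨hi, not_lt.1 h⟩
    have h3 := (card_le_card h2).trans (card_union_le _ _)
    rw [card_range] at h3
    omega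
  obtain ⟨G, hG, hGc⟩ := exists_subset_card_eq h1
  refine ⟨G, hG.trans (filter_subset _ _), hGc, fun n hn => ?_⟩
  have := (mem_filter.1 (hG hn)).2
  omega

/-- The smallest element of `F` lies in the `j`-th of the successive intervals determined by
`b`. -/
def StartsIn (b : ℕ → ℕ) (F : Finset ℕ) (j : ℕ) : Prop :=
  (∀ n ∈ F, b j ≤ n) ∧ ∃ n ∈ F, n < b (j + 1)

theorem StartsIn.unique {b : ℕ → ℕ} (hb : StrictMono b) {F : Finset ℕ} {i j : ℕ}
    (hi : StartsIn b F i) (hj : StartsIn b F j) : i = j := by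
  have key : ∀ i j, StartsIn b F i → StartsIn b F j → ¬ i < j := by
    rintro i j ⟨-, n, hn, hni⟩ ⟨hj, -⟩ hij
    have h1 := hj n hn
    have h2 := hb.monotone (Nat.succ_le_of_lt hij)
    simp only [Nat.succ_eq_add_one] at h2
    omega
  have h1 := key i j hi hj
  have h2 := key j i hj hi
  omega

theorem card_mul_le_of_early {b : ℕ} {η r : ℝ} (hη0 : 0 ≤ η) (hη : η * ((b : ℝ) + 1) ^ 2 ≤ r)
    {F : Finset ℕ} (hF : IsSchreier F) (hlow : ∃ n ∈ F, n < b) :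
    (F.card : ℝ) * η ≤ b * η ∧ (b : ℝ) * η ≤ r := by
  obtain ⟨n, hn, hnb⟩ := hlow
  have h1 : (F.card : ℝ) ≤ b := by
    have := hF n hn
    exact_mod_cast (by omega : F.card ≤ b)
  have hb0 : (0 : ℝ) ≤ b := Nat.cast_nonneg b
  refine ⟨by gcongr, ?_⟩
  nlinarith [mul_nonneg hη0 hb0, mul_nonneg (mul_nonneg hη0 hb0) hb0]

/-! ### The functionals defining the Schreier norm -/

theorem mu_nonneg (p : ℝ≥0) (x : ℕ → 𝕜) (F : Finset ℕ) : 0 ≤ mu p x F := by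
  unfold mu; positivity

theorem mu_mono (p : ℝ≥0) {x y : ℕ → 𝕜} {F : Finset ℕ} (h : ∀ n ∈ F, ‖x n‖ ≤ ‖y n‖) :
    mu p x F ≤ mu p y F := by
  unfold mu
  gcongr with n hn
  exact h n hn

theorem continuous_mu (p : ℝ≥0) (F : Finset ℕ) : Continuous fun x : ℕ → 𝕜 => mu p x F := by
  unfold mu
  refine Continuous.rpow_const ?_ fun _ => Or.inr (by positivity)
  exact continuous_finsetSum _ fun n _ =>
    ((continuous_apply n).norm).rpow_const fun _ => Or.inr p.2

theorem mu_eq_zero {p : ℝ≥0} (hp : 1 ≤ p) {x : ℕ → 𝕜} {F : Finset ℕ} (h : ∀ n ∈ F, x n = 0) :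
    mu p x F = 0 := by
  have hp0 : (p : ℝ) ≠ 0 := by exact_mod_cast (lt_of_lt_of_le one_pos hp).ne'
  unfold mu
  rw [Finset.sum_eq_zero fun n hn => by rw [h n hn, norm_zero, Real.zero_rpow hp0],
    Real.zero_rpow (by positivity)]

theorem mu_sum_le {p : ℝ≥0} (hp : 1 ≤ p) (s : Finset ℕ) (c : ℕ → 𝕜) (x : ℕ → ℕ → 𝕜)
    (F : Finset ℕ) : mu p (∑ j ∈ s, c j • x j) F ≤ ∑ j ∈ s, ‖c j‖ * mu p (x j) F := by
  classical
  induction s using Finset.induction_on with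
  | empty => simp [mu_eq_zero hp (x := (0 : ℕ → 𝕜)) (F := F) fun _ _ => rfl]
  | insert j s hj ih =>
    rw [Finset.sum_insert hj, Finset.sum_insert hj, ← mu_smul hp]
    exact (mu_add_le hp _ _ _).trans (add_le_add_right ih _)

theorem mu_le_card_mul {p : ℝ≥0} (hp : 1 ≤ p) {x : ℕ → 𝕜} {F : Finset ℕ} {η : ℝ} (hη0 : 0 ≤ η)
    (hη : ∀ n, ‖x n‖ ≤ η) : mu p x F ≤ F.card * η := by
  have hp1 : (1 : ℝ) ≤ p := by exact_mod_cast hp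
  have hp0 : (p : ℝ) ≠ 0 := by positivity
  have h1 : ∑ n ∈ F, ‖x n‖ ^ (p : ℝ) ≤ F.card * η ^ (p : ℝ) := by
    rw [← nsmul_eq_mul]
    exact Finset.sum_le_card_nsmul _ _ _ fun n _ =>
      Real.rpow_le_rpow (norm_nonneg _) (hη n) p.2
  have h2 : ((F.card : ℝ)) ^ (1 / (p : ℝ)) ≤ F.card := by
    rcases F.card.eq_zero_or_pos with h0 | h0
    · rw [h0, Nat.cast_zero, Real.zero_rpow (by positivity)]
    · have : (1 : ℝ) ≤ F.card := by exact_mod_cast h0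
      calc ((F.card : ℝ)) ^ (1 / (p : ℝ)) ≤ (F.card : ℝ) ^ (1 : ℝ) :=
            Real.rpow_le_rpow_of_exponent_le this (by rw [div_le_one (by positivity)]; exact hp1)
        _ = F.card := Real.rpow_one _
  calc mu p x F ≤ (F.card * η ^ (p : ℝ)) ^ (1 / (p : ℝ)) := by
        unfold mu
        gcongr
    _ = (F.card : ℝ) ^ (1 / (p : ℝ)) * η := by
        rw [Real.mul_rpow (by positivity) (by positivity), one_div, Real.rpow_rpow_inv hη0 hp0]
    _ ≤ F.card * η := by gcongr

/-! ### The Schreier spaces -/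

section Schreier

variable (𝕜) (p : ℝ≥0) [hp : Fact (1 ≤ p)]

/-- The coordinates of an element of `Z_p`. -/
def schreierZCoord : SchreierZ 𝕜 p →ₗ[𝕜] (ℕ → 𝕜) := (schreierSubmodule 𝕜 p).subtype

variable {𝕜 p}

theorem schreierZ_norm_le_iff (x : SchreierZ 𝕜 p) {M : ℝ} (hM : 0 ≤ M) :
    ‖x‖ ≤ M ↔ ∀ F, IsSchreier F → mu p (schreierZCoord 𝕜 p x) F ≤ M := by
  have hx : schreierENorm p x.1 < ∞ := x.2
  change (schreierENorm p x.1).toReal ≤ M ↔ _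
  rw [← ENNReal.le_ofReal_iff_toReal_le hx.ne hM, schreierENorm, iSup₂_le_iff]
  simp only [ENNReal.ofReal_le_ofReal_iff hM]
  rfl

theorem mu_le_schreierZ_norm (x : SchreierZ 𝕜 p) {F : Finset ℕ} (hF : IsSchreier F) :
    mu p (schreierZCoord 𝕜 p x) F ≤ ‖x‖ :=
  (schreierZ_norm_le_iff x (norm_nonneg x)).1 le_rfl F hF

theorem schreierZ_norm_coord_le (x : SchreierZ 𝕜 p) (n : ℕ) :
    ‖schreierZCoord 𝕜 p x n‖ ≤ ‖x‖ := by
  rw [← mu_singleton hp.out]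
  exact mu_le_schreierZ_norm x (isSchreier_singleton n)

instance : CompleteSpace (SchreierZ 𝕜 p) :=
  completeSpace_of_continuous_family (ι := {F : Finset ℕ // IsSchreier F}) (schreierZCoord 𝕜 p)
    (fun F x => mu p x F) (fun F => continuous_mu p F)
    (fun x M hM => by rw [schreierZ_norm_le_iff x hM, Subtype.forall])
    (fun z M hz => ⟨⟨z, lt_of_le_of_lt
      (iSup₂_le fun F hF => ENNReal.ofReal_le_ofReal (hz ⟨F, hF⟩)) ENNReal.ofReal_lt_top⟩, rfl⟩)
    schreierZ_norm_coord_le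

theorem schreierZ_solidBasis : SolidBasis (schreierZCoord 𝕜 p) (SchreierZ.unitVector 𝕜 p) where
  coord_basis _ := rfl
  norm_coord_le := schreierZ_norm_coord_le
  solid x y hxy := (schreierZ_norm_le_iff x (norm_nonneg y)).2 fun _ hF =>
    (mu_mono p fun n _ => hxy n).trans (mu_le_schreierZ_norm y hF)

variable (𝕜 p)

instance : CompleteSpace (SchreierSpace 𝕜 p) :=
  (Submodule.isClosed_topologicalClosure _).completeSpace_coe

/-- The coordinates of an element of `S_p`. -/
def schreierCoord : SchreierSpace 𝕜 p →ₗ[𝕜] (ℕ → 𝕜) :=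
  schreierZCoord 𝕜 p ∘ₗ Submodule.subtype _

/-- The unit vectors of `S_p`. -/
def schreierUnit (n : ℕ) : SchreierSpace 𝕜 p :=
  ⟨SchreierZ.unitVector 𝕜 p n, Submodule.le_topologicalClosure _ (Submodule.subset_span ⟨n, rfl⟩)⟩

variable {𝕜 p}

theorem schreier_solidBasis : SolidBasis (schreierCoord 𝕜 p) (schreierUnit 𝕜 p) where
  coord_basis _ := rfl
  norm_coord_le x := schreierZ_norm_coord_le x.1
  solid x y := schreierZ_solidBasis.solid x.1 y.1

theorem norm_schreierUnit_le (n : ℕ) : ‖schreierUnit 𝕜 p n‖ ≤ 1 :=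
  (schreierZ_norm_le_iff (SchreierZ.unitVector 𝕜 p n) zero_le_one).2 fun F _ =>
    mu_single_le hp.out n F

theorem tendsto_trunc_schreier (x : SchreierSpace 𝕜 p) :
    Tendsto (fun n => trunc (schreierCoord 𝕜 p) (schreierUnit 𝕜 p) n x) atTop (𝓝 x) := by
  rw [Metric.tendsto_atTop]
  intro ε hε
  have hx : (x : SchreierZ 𝕜 p) ∈ closure
      (Submodule.span 𝕜 (Set.range (SchreierZ.unitVector 𝕜 p)) : Set (SchreierZ 𝕜 p)) := x.2
  obtain ⟨y, hy, hxy⟩ := Metric.mem_closure_iff.1 hx ε hε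
  have hfin : ∃ N, ∀ k, N ≤ k → schreierZCoord 𝕜 p y k = 0 := by
    refine Submodule.span_induction (p := fun y _ => ∃ N, ∀ k, N ≤ k → schreierZCoord 𝕜 p y k = 0)
      ?_ ⟨0, fun k _ => by simp⟩ ?_ ?_ hy
    · rintro _ ⟨n, rfl⟩
      refine ⟨n + 1, fun k hk => ?_⟩
      rw [schreierZ_solidBasis.coord_basis, Pi.single_eq_of_ne (by omega)]
    · rintro a b - - ⟨M, hM⟩ ⟨N, hN⟩
      refine ⟨max M N, fun k hk => ?_⟩
      rw [map_add, Pi.add_apply, hM k (le_of_max_le_left hk), hN k (le_of_max_le_right hk),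
        add_zero]
    · rintro c a - ⟨N, hN⟩
      exact ⟨N, fun k hk => by rw [map_smul, Pi.smul_apply, hN k hk, smul_zero]⟩
  obtain ⟨N, hN⟩ := hfin
  refine ⟨N, fun n hn => lt_of_le_of_lt ?_ hxy⟩
  rw [dist_comm, dist_eq_norm, dist_eq_norm]
  refine schreierZ_solidBasis.solid (x - trunc (schreierCoord 𝕜 p) (schreierUnit 𝕜 p) n x).1
    (x.1 - y) fun k => ?_
  change ‖schreierCoord 𝕜 p (x - trunc (schreierCoord 𝕜 p) (schreierUnit 𝕜 p) n x) k‖ ≤ _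
  rw [map_sub, map_sub, Pi.sub_apply, Pi.sub_apply, schreier_solidBasis.coord_trunc]
  split_ifs with hk
  · simp
  · rw [hN k (by omega)]
    exact le_rfl

theorem schreier_flat (M : ℝ) : ∃ n : ℕ, ∀ (A : Finset ℕ) (x : SchreierSpace 𝕜 p), A.card = n →
    (∀ i ∈ A, ‖schreierCoord 𝕜 p x i‖ = 1) → M ≤ ‖x‖ := by
  have hp0 : 0 < (p : ℝ) := by exact_mod_cast lt_of_lt_of_le one_pos hp.out
  have htop : Tendsto (fun n : ℕ => (n : ℝ) ^ (1 / (p : ℝ))) atTop atTop :=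
    (tendsto_rpow_atTop (by positivity)).comp tendsto_natCast_atTop_atTop
  obtain ⟨m, hm⟩ := (htop.eventually (eventually_ge_atTop M)).exists
  refine ⟨2 * m, fun A x hA hxA => ?_⟩
  obtain ⟨G, hGA, hG, hGS⟩ := exists_schreier_subset hA
  have h1 : mu p (schreierCoord 𝕜 p x) G = (m : ℝ) ^ (1 / (p : ℝ)) := by
    unfold mu
    rw [Finset.sum_congr rfl fun n hn => by rw [hxA n (hGA hn), Real.one_rpow]]
    simp [hG]
  exact hm.trans (h1 ▸ mu_le_schreierZ_norm x.1 hGS)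

theorem schreier_blocksDominated : BlocksDominated (schreierCoord 𝕜 p) (czeroUnit 𝕜) 3 := by
  classical
  intro w b hb hw1 hsupp hsmall s c
  set K := ‖∑ j ∈ s, c j • czeroUnit 𝕜 j‖ with hK
  have hK0 : 0 ≤ K := norm_nonneg _
  refine (schreierZ_norm_le_iff _ (by positivity)).2 fun F hF => ?_
  change mu p (schreierCoord 𝕜 p (∑ j ∈ s, c j • w j)) F ≤ _
  have hterm : ∀ j, mu p (schreierCoord 𝕜 p (w j)) F ≤
      (1 / 2) ^ j + if StartsIn b F j then 1 else 0 := by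
    intro j
    by_cases hlow : ∃ n ∈ F, n < b j
    · have hpos : (0 : ℝ) < ((b j : ℝ) + 1) ^ 2 := by positivity
      obtain ⟨h1, h2⟩ := card_mul_le_of_early (b := b j)
        (η := (1 / 2) ^ j / ((b j : ℝ) + 1) ^ 2) (r := (1 / 2) ^ j) (by positivity)
        (div_mul_cancel₀ _ hpos.ne').le hF hlow
      have h3 := mu_le_card_mul hp.out (x := schreierCoord 𝕜 p (w j)) (F := F)
        (η := (1 / 2) ^ j / ((b j : ℝ) + 1) ^ 2) (by positivity)
        fun n => (le_div_iff₀ hpos).2 (hsmall j n)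
      have h4 : (0 : ℝ) ≤ if StartsIn b F j then 1 else 0 := by split_ifs <;> norm_num
      linarith
    · push Not at hlow
      by_cases hnear : StartsIn b F j
      · rw [if_pos hnear]
        have h1 := (mu_le_schreierZ_norm (w j).1 hF).trans (hw1 j)
        have h2 : (0 : ℝ) ≤ (1 / 2) ^ j := by positivity
        change mu p (schreierCoord 𝕜 p (w j)) F ≤ 1 at h1
        linarith
      · rw [if_neg hnear, add_zero, mu_eq_zero hp.out]
        · positivity
        · intro n hn
          by_contra hne
          exact hnear ⟨hlow, n, hn, (hsupp j n hne).2⟩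
  have hcard : ∑ j ∈ s, (if StartsIn b F j then (1 : ℝ) else 0) ≤ 1 := by
    rw [Finset.sum_boole]
    have : (s.filter (StartsIn b F)).card ≤ 1 := card_le_one.2 fun i hi j hj =>
      (mem_filter.1 hi).2.unique hb (mem_filter.1 hj).2
    exact_mod_cast this
  calc mu p (schreierCoord 𝕜 p (∑ j ∈ s, c j • w j)) F
      ≤ ∑ j ∈ s, ‖c j‖ * mu p (schreierCoord 𝕜 p (w j)) F := by
        rw [map_sum]
        simp_rw [map_smul]
        exact mu_sum_le hp.out s c (fun j => schreierCoord 𝕜 p (w j)) F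
    _ ≤ ∑ j ∈ s, K * ((1 / 2) ^ j + if StartsIn b F j then 1 else 0) :=
        Finset.sum_le_sum fun j hj =>
          mul_le_mul (norm_coeff_le_czero s c hj) (hterm j) (mu_nonneg _ _ _) hK0
    _ = K * (∑ j ∈ s, (1 / 2 : ℝ) ^ j + ∑ j ∈ s, if StartsIn b F j then (1 : ℝ) else 0) := by
        rw [← Finset.sum_add_distrib, Finset.mul_sum]
    _ ≤ K * (2 + 1) := by
        gcongr
        exact sum_le_hasSum s (fun j _ => by positivity) hasSum_geometric_two
    _ = 3 * K := by ring

theorem tfae_schreier (T : SchreierSpace 𝕜 p →L[𝕜] SchreierSpace 𝕜 p) :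
    List.TFAE [IsFinitelyStrictlySingular T, IsStrictlySingular T, ¬ FixesCopyOf (CZero 𝕜) T,
      ¬ IdFactorsThrough (CZero 𝕜) T] :=
  tfae_of_idFactorsThrough czero_spreadingBasis.not_finiteDimensional T
    (schreier_solidBasis.idFactorsThrough_of_not_fss norm_schreierUnit_le tendsto_trunc_schreier
      schreier_flat czero_spreadingBasis zero_le_three schreier_blocksDominated
      (blocksDominate_czero schreier_solidBasis tendsto_trunc_schreier) T)

end Schreier

/-! ### The functionals defining the Baernstein norm -/

theorem continuous_beta (p : ℝ≥0) (C : Finset (Finset ℕ)) :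
    Continuous fun x : ℕ → 𝕜 => beta p x C := by
  unfold beta
  refine Continuous.rpow_const ?_ fun _ => Or.inr (by positivity)
  refine continuous_finsetSum _ fun F _ => Continuous.rpow_const ?_ fun _ => Or.inr p.2
  exact continuous_finsetSum _ fun n _ => (continuous_apply n).norm

theorem beta_mono (p : ℝ≥0) {x y : ℕ → 𝕜} {C : Finset (Finset ℕ)} (h : ∀ n, ‖x n‖ ≤ ‖y n‖) :
    beta p x C ≤ beta p y C := by
  unfold beta
  gcongr with F _ n _
  exact h n

theorem beta_rpow {p : ℝ≥0} (hp : 1 ≤ p) (x : ℕ → 𝕜) (C : Finset (Finset ℕ)) :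
    beta p x C ^ (p : ℝ) = ∑ F ∈ C, (∑ n ∈ F, ‖x n‖) ^ (p : ℝ) := by
  have hp0 : (p : ℝ) ≠ 0 := by exact_mod_cast (lt_of_lt_of_le one_pos hp).ne'
  unfold beta
  rw [one_div, Real.rpow_inv_rpow (by positivity) hp0]

theorem IsSchreierChain.eq_of_mem {C : Finset (Finset ℕ)} (hC : IsSchreierChain C)
    {F G : Finset ℕ} (hF : F ∈ C) (hG : G ∈ C) {n : ℕ} (hnF : n ∈ F) (hnG : n ∈ G) : F = G := by
  by_contra hne
  rcases hC.consecutive F hF G hG hne with h | h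
  · exact lt_irrefl n (h n hnF n hnG)
  · exact lt_irrefl n (h n hnG n hnF)

theorem beta_single_le {p : ℝ≥0} (hp : 1 ≤ p) (n : ℕ) {C : Finset (Finset ℕ)}
    (hC : IsSchreierChain C) : beta p (Pi.single n (1 : 𝕜)) C ≤ 1 := by
  have hp0 : (p : ℝ) ≠ 0 := by exact_mod_cast (lt_of_lt_of_le one_pos hp).ne'
  have h1 : ∀ F : Finset ℕ, (∑ k ∈ F, ‖(Pi.single n (1 : 𝕜) : ℕ → 𝕜) k‖) ^ (p : ℝ) =
      if n ∈ F then 1 else 0 := by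
    intro F
    have h2 : ∀ k, ‖(Pi.single n (1 : 𝕜) : ℕ → 𝕜) k‖ = if k = n then 1 else 0 := fun k => by
      by_cases h : k = n
      · subst h; simp
      · simp [h]
    simp only [h2, Finset.sum_ite_eq']
    split_ifs
    · exact Real.one_rpow _
    · exact Real.zero_rpow hp0
  unfold beta
  simp only [h1]
  refine Real.rpow_le_one (Finset.sum_nonneg fun F _ => by split_ifs <;> norm_num) ?_
    (by positivity)
  rw [Finset.sum_boole]
  have : (C.filter (n ∈ ·)).card ≤ 1 := card_le_one.2 fun F hF G hG =>
    hC.eq_of_mem (mem_filter.1 hF).1 (mem_filter.1 hG).1 (mem_filter.1 hF).2 (mem_filter.1 hG).2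
  exact_mod_cast this

theorem sum_rpow_le_rpow_sum {ι : Type*} (s : Finset ι) {f : ι → ℝ} (hf : ∀ i, 0 ≤ f i) {p : ℝ}
    (hp : 1 ≤ p) : ∑ i ∈ s, f i ^ p ≤ (∑ i ∈ s, f i) ^ p := by
  classical
  induction s using Finset.induction_on with
  | empty => simp [Real.zero_rpow (by linarith : p ≠ 0)]
  | insert i s hi ih =>
    rw [Finset.sum_insert hi, Finset.sum_insert hi]
    exact (add_le_add_right ih _).trans
      (Real.add_rpow_le_rpow_add (hf i) (Finset.sum_nonneg fun j _ => hf j) hp)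

theorem rpow_sum_eq_of_card_le_one {ι : Type*} {s : Finset ι} (hs : s.card ≤ 1) (f : ι → ℝ) {p : ℝ}
    (hp : p ≠ 0) : (∑ i ∈ s, f i) ^ p = ∑ i ∈ s, f i ^ p := by
  rcases Nat.le_one_iff_eq_zero_or_eq_one.1 hs with h | h
  · rw [card_eq_zero.1 h]; simp [Real.zero_rpow hp]
  · obtain ⟨i, rfl⟩ := card_eq_one.1 h
    simp

/-! ### The Baernstein spaces -/

section Baernstein

variable (𝕜) (p : ℝ≥0) [hp : Fact (1 ≤ p)]

/-- The coordinates of an element of `B_p`. -/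
def baernsteinCoord : BaernsteinSpace 𝕜 p →ₗ[𝕜] (ℕ → 𝕜) := (baernsteinSubmodule 𝕜 p).subtype

/-- The unit vectors of `B_p`. -/
def baernsteinUnit (n : ℕ) : BaernsteinSpace 𝕜 p :=
  ⟨Pi.single n 1, by
    change baernsteinENorm p (Pi.single n (1 : 𝕜)) < ∞
    refine lt_of_le_of_lt (iSup₂_le fun C hC => ?_) ENNReal.one_lt_top
    exact ENNReal.ofReal_le_one.2 (beta_single_le hp.out n hC)⟩

variable {𝕜 p}

theorem baernstein_norm_le_iff (x : BaernsteinSpace 𝕜 p) {M : ℝ} (hM : 0 ≤ M) :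
    ‖x‖ ≤ M ↔ ∀ C, IsSchreierChain C → beta p (baernsteinCoord 𝕜 p x) C ≤ M := by
  have hx : baernsteinENorm p x.1 < ∞ := x.2
  change (baernsteinENorm p x.1).toReal ≤ M ↔ _
  rw [← ENNReal.le_ofReal_iff_toReal_le hx.ne hM, baernsteinENorm, iSup₂_le_iff]
  simp only [ENNReal.ofReal_le_ofReal_iff hM]
  rfl

theorem beta_le_baernstein_norm (x : BaernsteinSpace 𝕜 p) {C : Finset (Finset ℕ)}
    (hC : IsSchreierChain C) : beta p (baernsteinCoord 𝕜 p x) C ≤ ‖x‖ :=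
  (baernstein_norm_le_iff x (norm_nonneg x)).1 le_rfl C hC

theorem baernstein_norm_coord_le (x : BaernsteinSpace 𝕜 p) (n : ℕ) :
    ‖baernsteinCoord 𝕜 p x n‖ ≤ ‖x‖ := by
  rw [← beta_singleton hp.out]
  exact beta_le_baernstein_norm x (isSchreierChain_singleton n)

instance : CompleteSpace (BaernsteinSpace 𝕜 p) :=
  completeSpace_of_continuous_family (ι := {C : Finset (Finset ℕ) // IsSchreierChain C})
    (baernsteinCoord 𝕜 p) (fun C x => beta p x C) (fun C => continuous_beta p C)
    (fun x M hM => by rw [baernstein_norm_le_iff x hM, Subtype.forall])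
    (fun z M hz => ⟨⟨z, lt_of_le_of_lt
      (iSup₂_le fun C hC => ENNReal.ofReal_le_ofReal (hz ⟨C, hC⟩)) ENNReal.ofReal_lt_top⟩, rfl⟩)
    baernstein_norm_coord_le

theorem baernstein_solidBasis : SolidBasis (baernsteinCoord 𝕜 p) (baernsteinUnit 𝕜 p) where
  coord_basis _ := rfl
  norm_coord_le := baernstein_norm_coord_le
  solid x y hxy := (baernstein_norm_le_iff x (norm_nonneg y)).2 fun _ hC =>
    (beta_mono p hxy).trans (beta_le_baernstein_norm y hC)

theorem norm_baernsteinUnit_le (n : ℕ) : ‖baernsteinUnit 𝕜 p n‖ ≤ 1 :=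
  (baernstein_norm_le_iff _ zero_le_one).2 fun _ hC => beta_single_le hp.out n hC

theorem baernstein_norm_rpow_le {x : BaernsteinSpace 𝕜 p} {M : ℝ}
    (h : ∀ C, IsSchreierChain C →
      ∑ F ∈ C, (∑ n ∈ F, ‖baernsteinCoord 𝕜 p x n‖) ^ (p : ℝ) ≤ M) : ‖x‖ ^ (p : ℝ) ≤ M := by
  have hp0 : 0 < (p : ℝ) := by exact_mod_cast lt_of_lt_of_le one_pos hp.out
  have hM : 0 ≤ M := le_trans (by positivity) (h _ (isSchreierChain_singleton 0))
  have h1 : ‖x‖ ≤ M ^ (1 / (p : ℝ)) := by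
    refine (baernstein_norm_le_iff x (by positivity)).2 fun C hC => ?_
    unfold beta
    gcongr
    exact h C hC
  calc ‖x‖ ^ (p : ℝ) ≤ (M ^ (1 / (p : ℝ))) ^ (p : ℝ) := by gcongr
    _ = M := by rw [one_div, Real.rpow_inv_rpow hM hp0.ne']

/-- The norm dominates the sums over indexed families of successive, possibly empty, Schreier
sets. -/
theorem sum_rpow_le_baernstein_norm_rpow {ι : Type*} (s : Finset ι) (F : ι → Finset ℕ)
    (hS : ∀ i ∈ s, IsSchreier (F i))
    (hF : ∀ i ∈ s, ∀ j ∈ s, i ≠ j → SetLT (F i) (F j) ∨ SetLT (F j) (F i))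
    (x : BaernsteinSpace 𝕜 p) :
    ∑ i ∈ s, (∑ n ∈ F i, ‖baernsteinCoord 𝕜 p x n‖) ^ (p : ℝ) ≤ ‖x‖ ^ (p : ℝ) := by
  classical
  have hp0 : 0 < (p : ℝ) := by exact_mod_cast lt_of_lt_of_le one_pos hp.out
  have hfil : ∑ i ∈ s with (F i).Nonempty, (∑ n ∈ F i, ‖baernsteinCoord 𝕜 p x n‖) ^ (p : ℝ) =
      ∑ i ∈ s, (∑ n ∈ F i, ‖baernsteinCoord 𝕜 p x n‖) ^ (p : ℝ) := by
    refine Finset.sum_filter_of_ne fun i _ hne => ?_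
    by_contra hemp
    rw [not_nonempty_iff_eq_empty] at hemp
    exact hne (by rw [hemp, Finset.sum_empty, Real.zero_rpow hp0.ne'])
  rw [← hfil]
  rcases (s.filter fun i => (F i).Nonempty).eq_empty_or_nonempty with h0 | h0
  · rw [h0, Finset.sum_empty]; positivity
  have hinj : Set.InjOn F (s.filter fun i => (F i).Nonempty : Finset ι) := by
    intro i hi j hj hij
    obtain ⟨his, n, hn⟩ := mem_filter.1 hi
    by_contra hne
    rcases hF i his j (mem_filter.1 hj).1 hne with h | h
    · exact lt_irrefl n (h n hn n (hij ▸ hn))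
    · exact lt_irrefl n (h n (hij ▸ hn) n hn)
  have hC : IsSchreierChain ((s.filter fun i => (F i).Nonempty).image F) :=
    { nonempty := h0.image F
      nonempty_of_mem := by
        intro G hG
        obtain ⟨i, hi, rfl⟩ := mem_image.1 hG
        exact (mem_filter.1 hi).2
      isSchreier_of_mem := by
        intro G hG
        obtain ⟨i, hi, rfl⟩ := mem_image.1 hG
        exact hS i (mem_filter.1 hi).1
      consecutive := by
        intro G hG H hH hne
        obtain ⟨i, hi, rfl⟩ := mem_image.1 hG
        obtain ⟨j, hj, rfl⟩ := mem_image.1 hH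
        exact hF i (mem_filter.1 hi).1 j (mem_filter.1 hj).1 fun h => hne (by rw [h]) }
  rw [← Finset.sum_image (f := fun G => (∑ n ∈ G, ‖baernsteinCoord 𝕜 p x n‖) ^ (p : ℝ)) hinj,
    ← beta_rpow hp.out]
  exact Real.rpow_le_rpow (by unfold beta; positivity) (beta_le_baernstein_norm x hC) hp0.le

theorem trunc_rpow_add_le (m : ℕ) (x : BaernsteinSpace 𝕜 p) :
    ‖trunc (baernsteinCoord 𝕜 p) (baernsteinUnit 𝕜 p) m x‖ ^ (p : ℝ) +
      ‖x - trunc (baernsteinCoord 𝕜 p) (baernsteinUnit 𝕜 p) m x‖ ^ (p : ℝ) ≤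
        ‖x‖ ^ (p : ℝ) := by
  set a := trunc (baernsteinCoord 𝕜 p) (baernsteinUnit 𝕜 p) m x with ha
  have hac : ∀ k, baernsteinCoord 𝕜 p a k = if k < m then baernsteinCoord 𝕜 p x k else 0 :=
    baernstein_solidBasis.coord_trunc m x
  have hrc : ∀ k, baernsteinCoord 𝕜 p (x - a) k =
      if m ≤ k then baernsteinCoord 𝕜 p x k else 0 := fun k => by
    rw [map_sub, Pi.sub_apply, hac]
    split_ifs <;> first | omega | simp
  have key : ∀ C, IsSchreierChain C → ∀ C', IsSchreierChain C' →
      ∑ F ∈ C, (∑ n ∈ F, ‖baernsteinCoord 𝕜 p a n‖) ^ (p : ℝ) +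
        ∑ F ∈ C', (∑ n ∈ F, ‖baernsteinCoord 𝕜 p (x - a) n‖) ^ (p : ℝ) ≤ ‖x‖ ^ (p : ℝ) := by
    intro C hC C' hC'
    have h1 := sum_rpow_le_baernstein_norm_rpow (C.disjSum C')
      (Sum.elim (fun F => F.filter (· < m)) (fun F => F.filter (m ≤ ·))) (by
        rintro (F | F) hF
        · exact (hC.isSchreier_of_mem F (by simpa using hF)).subset (filter_subset _ _)
        · exact (hC'.isSchreier_of_mem F (by simpa using hF)).subset (filter_subset _ _)) (by
        rintro (F | F) hF (G | G) hG hne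
        · rw [inl_mem_disjSum] at hF hG
          exact (hC.consecutive F hF G hG fun h => hne (by rw [h])).imp
            (·.subset (filter_subset _ _) (filter_subset _ _))
            (·.subset (filter_subset _ _) (filter_subset _ _))
        · exact Or.inl fun i hi j hj => lt_of_lt_of_le (mem_filter.1 hi).2 (mem_filter.1 hj).2
        · exact Or.inr fun i hi j hj => lt_of_lt_of_le (mem_filter.1 hi).2 (mem_filter.1 hj).2
        · rw [inr_mem_disjSum] at hF hG
          exact (hC'.consecutive F hF G hG fun h => hne (by rw [h])).imp
            (·.subset (filter_subset _ _) (filter_subset _ _))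
            (·.subset (filter_subset _ _) (filter_subset _ _))) x
    rw [Finset.sum_disjSum] at h1
    simp only [Sum.elim_inl, Sum.elim_inr, Finset.sum_filter] at h1
    simp only [hac, hrc, apply_ite norm, norm_zero]
    exact h1
  have h1 : ∀ C', IsSchreierChain C' → ‖a‖ ^ (p : ℝ) ≤ ‖x‖ ^ (p : ℝ) -
      ∑ F ∈ C', (∑ n ∈ F, ‖baernsteinCoord 𝕜 p (x - a) n‖) ^ (p : ℝ) := fun C' hC' =>
    baernstein_norm_rpow_le fun C hC => by linarith [key C hC C' hC']
  have h2 : ‖x - a‖ ^ (p : ℝ) ≤ ‖x‖ ^ (p : ℝ) - ‖a‖ ^ (p : ℝ) :=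
    baernstein_norm_rpow_le fun C' hC' => by linarith [h1 C' hC']
  linarith

theorem tendsto_trunc_baernstein (x : BaernsteinSpace 𝕜 p) :
    Tendsto (fun n => trunc (baernsteinCoord 𝕜 p) (baernsteinUnit 𝕜 p) n x) atTop (𝓝 x) := by
  have hp0 : 0 < (p : ℝ) := by exact_mod_cast lt_of_lt_of_le one_pos hp.out
  rw [Metric.tendsto_atTop]
  intro ε hε
  have hεp : 0 < ε ^ (p : ℝ) := by positivity
  obtain ⟨C, hC, hCx⟩ : ∃ C, IsSchreierChain C ∧ ‖x‖ ^ (p : ℝ) - ε ^ (p : ℝ) <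
      ∑ F ∈ C, (∑ n ∈ F, ‖baernsteinCoord 𝕜 p x n‖) ^ (p : ℝ) := by
    by_contra! hcon
    linarith [baernstein_norm_rpow_le hcon]
  obtain ⟨N, hN⟩ := (C.biUnion id).exists_nat_subset_range
  refine ⟨N, fun n hn => ?_⟩
  set a := trunc (baernsteinCoord 𝕜 p) (baernsteinUnit 𝕜 p) n x with ha
  have h1 : ∑ F ∈ C, (∑ k ∈ F, ‖baernsteinCoord 𝕜 p x k‖) ^ (p : ℝ) =
      ∑ F ∈ C, (∑ k ∈ F, ‖baernsteinCoord 𝕜 p a k‖) ^ (p : ℝ) := by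
    refine Finset.sum_congr rfl fun F hF => ?_
    congr 1
    refine Finset.sum_congr rfl fun k hk => ?_
    have hkN : k < N := mem_range.1 (hN (mem_biUnion.2 ⟨F, hF, hk⟩))
    rw [ha, baernstein_solidBasis.coord_trunc, if_pos (by omega)]
  have h2 : ∑ F ∈ C, (∑ k ∈ F, ‖baernsteinCoord 𝕜 p a k‖) ^ (p : ℝ) ≤ ‖a‖ ^ (p : ℝ) := by
    rw [← beta_rpow hp.out]
    exact Real.rpow_le_rpow (by unfold beta; positivity) (beta_le_baernstein_norm a hC) hp0.le
  have h3 := trunc_rpow_add_le n x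
  rw [← ha] at h3
  rw [dist_comm, dist_eq_norm]
  exact (Real.rpow_lt_rpow_iff (norm_nonneg _) hε.le hp0).1 (by linarith)

theorem trunc_rpow_add_trunc_sub_le (m n : ℕ) (x : BaernsteinSpace 𝕜 p) (hmn : m ≤ n) :
    ‖trunc (baernsteinCoord 𝕜 p) (baernsteinUnit 𝕜 p) m x‖ ^ (p : ℝ) +
      ‖trunc (baernsteinCoord 𝕜 p) (baernsteinUnit 𝕜 p) n x -
        trunc (baernsteinCoord 𝕜 p) (baernsteinUnit 𝕜 p) m x‖ ^ (p : ℝ) ≤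
      ‖trunc (baernsteinCoord 𝕜 p) (baernsteinUnit 𝕜 p) n x‖ ^ (p : ℝ) := by
  have h := trunc_rpow_add_le m (trunc (baernsteinCoord 𝕜 p) (baernsteinUnit 𝕜 p) n x)
  rwa [baernstein_solidBasis.trunc_trunc, min_eq_left hmn] at h

theorem baernstein_flat (M : ℝ) : ∃ n : ℕ, ∀ (A : Finset ℕ) (x : BaernsteinSpace 𝕜 p),
    A.card = n → (∀ i ∈ A, ‖baernsteinCoord 𝕜 p x i‖ = 1) → M ≤ ‖x‖ := by
  have hp0 : 0 < (p : ℝ) := by exact_mod_cast lt_of_lt_of_le one_pos hp.out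
  obtain ⟨m, hm⟩ := exists_nat_ge M
  refine ⟨2 * m, fun A x hA hxA => hm.trans ?_⟩
  obtain ⟨G, hGA, hG, hGS⟩ := exists_schreier_subset hA
  have h1 := sum_rpow_le_baernstein_norm_rpow (univ : Finset Unit) (fun _ => G)
    (fun _ _ => hGS) (fun i _ j _ hne => absurd (Subsingleton.elim i j) hne) x
  rw [Finset.sum_congr rfl fun n hn => hxA n (hGA hn)] at h1
  simp only [univ_unique, sum_const, card_singleton, one_smul, nsmul_eq_mul, mul_one, hG] at h1
  exact (Real.rpow_le_rpow_iff (Nat.cast_nonneg m) (norm_nonneg x) hp0).1 h1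

theorem baernstein_blocksDominated :
    BlocksDominated (baernsteinCoord 𝕜 p) (ellPUnit 𝕜 p) 3 := by
  classical
  intro w b hb hw1 hsupp hsmall s c
  have hp1 : (1 : ℝ) ≤ p := by exact_mod_cast hp.out
  have hp0 : 0 < (p : ℝ) := by linarith
  set K := ‖∑ j ∈ s, c j • ellPUnit 𝕜 p j‖ with hK
  have hK0 : 0 ≤ K := norm_nonneg _
  have hKp : K ^ (p : ℝ) = ∑ j ∈ s, ‖c j‖ ^ (p : ℝ) :=
    norm_sum_ellPUnit_rpow (p := p) Function.injective_id s c
  have hcK : ∀ j ∈ s, ‖c j‖ ≤ K := fun j hj => by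
    rw [← Real.rpow_le_rpow_iff (norm_nonneg _) hK0 hp0, hKp]
    exact Finset.single_le_sum (f := fun j => ‖c j‖ ^ (p : ℝ)) (fun i _ => by positivity) hj
  refine (baernstein_norm_le_iff _ (by positivity)).2 fun C hC => ?_
  set ν : ℕ → Finset ℕ → ℝ := fun j F => ∑ n ∈ F, ‖baernsteinCoord 𝕜 p (w j) n‖ with hν
  have hν0 : ∀ j F, 0 ≤ ν j F := fun j F => by positivity
  set a : Finset ℕ → ℝ := fun F => ∑ j ∈ s with StartsIn b F j, ‖c j‖ * ν j F with ha
  set l : Finset ℕ → ℝ := fun F => ∑ j ∈ s with (∃ n ∈ F, n < b j), ‖c j‖ * ν j F with hl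
  have ha0 : ∀ F, 0 ≤ a F := fun F =>
    Finset.sum_nonneg fun j _ => mul_nonneg (norm_nonneg _) (hν0 _ _)
  have hl0 : ∀ F, 0 ≤ l F := fun F =>
    Finset.sum_nonneg fun j _ => mul_nonneg (norm_nonneg _) (hν0 _ _)
  have hsplit : ∀ F, ∑ n ∈ F, ‖baernsteinCoord 𝕜 p (∑ j ∈ s, c j • w j) n‖ ≤ a F + l F := by
    intro F
    have h1 : ∑ n ∈ F, ‖baernsteinCoord 𝕜 p (∑ j ∈ s, c j • w j) n‖ ≤
        ∑ j ∈ s, ‖c j‖ * ν j F := by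
      calc ∑ n ∈ F, ‖baernsteinCoord 𝕜 p (∑ j ∈ s, c j • w j) n‖
          ≤ ∑ n ∈ F, ∑ j ∈ s, ‖c j‖ * ‖baernsteinCoord 𝕜 p (w j) n‖ := by
            refine Finset.sum_le_sum fun n _ => ?_
            rw [map_sum, Finset.sum_apply]
            refine (norm_sum_le _ _).trans (Finset.sum_le_sum fun j _ => ?_)
            rw [map_smul, Pi.smul_apply, norm_smul]
        _ = ∑ j ∈ s, ‖c j‖ * ν j F := by
            rw [Finset.sum_comm]
            exact Finset.sum_congr rfl fun j _ => (Finset.mul_sum _ _ _).symm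
    refine h1.trans ?_
    simp only [ha, hl, Finset.sum_filter]
    rw [← Finset.sum_add_distrib]
    refine Finset.sum_le_sum fun j _ => ?_
    have hnn : 0 ≤ ‖c j‖ * ν j F := mul_nonneg (norm_nonneg _) (hν0 _ _)
    by_cases hlow : ∃ n ∈ F, n < b j
    · rw [if_pos hlow]
      split_ifs <;> linarith
    · by_cases hnear : StartsIn b F j
      · rw [if_pos hnear, if_neg hlow, add_zero]
      · rw [if_neg hnear, if_neg hlow, add_zero]
        push Not at hlow
        have : ν j F = 0 := by
          refine Finset.sum_eq_zero fun n hn => ?_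
          by_contra hne
          rw [norm_eq_zero] at hne
          exact hnear ⟨hlow, n, hn, (hsupp j n hne).2⟩
        rw [this, mul_zero]
  have hA : (∑ F ∈ C, a F ^ (p : ℝ)) ^ (1 / (p : ℝ)) ≤ K := by
    have h1 : ∑ F ∈ C, a F ^ (p : ℝ) ≤ K ^ (p : ℝ) := by
      calc ∑ F ∈ C, a F ^ (p : ℝ)
          ≤ ∑ F ∈ C, ∑ j ∈ s, ‖c j‖ ^ (p : ℝ) * ν j F ^ (p : ℝ) := by
            refine Finset.sum_le_sum fun F _ => ?_
            have hcard : (s.filter (StartsIn b F)).card ≤ 1 := card_le_one.2 fun i hi j hj =>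
              (mem_filter.1 hi).2.unique hb (mem_filter.1 hj).2
            rw [ha]
            simp only
            rw [rpow_sum_eq_of_card_le_one hcard _ hp0.ne']
            simp_rw [Real.mul_rpow (norm_nonneg _) (hν0 _ _)]
            exact Finset.sum_le_sum_of_subset_of_nonneg (filter_subset _ _) fun j _ _ =>
              mul_nonneg (by positivity) (Real.rpow_nonneg (hν0 _ _) _)
        _ = ∑ j ∈ s, ‖c j‖ ^ (p : ℝ) * ∑ F ∈ C, ν j F ^ (p : ℝ) := by
            rw [Finset.sum_comm]
            simp_rw [Finset.mul_sum]
        _ ≤ ∑ j ∈ s, ‖c j‖ ^ (p : ℝ) * 1 := by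
            gcongr with j hj
            have h2 : beta p (baernsteinCoord 𝕜 p (w j)) C ^ (p : ℝ) ≤ 1 :=
              Real.rpow_le_one (by unfold beta; positivity)
                ((beta_le_baernstein_norm (w j) hC).trans (hw1 j)) hp0.le
            rwa [beta_rpow hp.out] at h2
        _ = K ^ (p : ℝ) := by simp_rw [mul_one, hKp]
    calc (∑ F ∈ C, a F ^ (p : ℝ)) ^ (1 / (p : ℝ)) ≤ (K ^ (p : ℝ)) ^ (1 / (p : ℝ)) :=
          Real.rpow_le_rpow (Finset.sum_nonneg fun F _ => Real.rpow_nonneg (ha0 F) _) h1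
            (by positivity)
      _ = K := by rw [one_div, Real.rpow_rpow_inv hK0 hp0.ne']
  have hL : (∑ F ∈ C, l F ^ (p : ℝ)) ^ (1 / (p : ℝ)) ≤ 2 * K := by
    have h1 : ∀ j, ∑ F ∈ C with (∃ n ∈ F, n < b j), ν j F ≤ (1 / 2) ^ j := by
      intro j
      have hpos : (0 : ℝ) < ((b j : ℝ) + 1) ^ 2 := by positivity
      set η : ℝ := (1 / 2) ^ j / ((b j : ℝ) + 1) ^ 2 with hη
      have hη0 : 0 ≤ η := by positivity
      have hηeq : η * ((b j : ℝ) + 1) ^ 2 ≤ (1 / 2) ^ j := (div_mul_cancel₀ _ hpos.ne').le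
      have hcard : (C.filter fun F => ∃ n ∈ F, n < b j).card ≤ b j := by
        have := card_le_card_of_forall_subsingleton (s := C.filter fun F => ∃ n ∈ F, n < b j)
          (t := range (b j)) (fun F n => n ∈ F) (by
            intro F hF
            obtain ⟨-, n, hn, hnb⟩ := mem_filter.1 hF
            exact ⟨n, mem_range.2 hnb, hn⟩) (by
            rintro n - F ⟨hF, hnF⟩ G ⟨hG, hnG⟩
            exact hC.eq_of_mem (mem_filter.1 hF).1 (mem_filter.1 hG).1 hnF hnG)
        rwa [card_range] at this
      have hterm : ∀ F ∈ C.filter (fun F => ∃ n ∈ F, n < b j), ν j F ≤ b j * η := by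
        intro F hF
        obtain ⟨hFC, hlow⟩ := mem_filter.1 hF
        have h2 : ν j F ≤ F.card * η := by
          rw [← nsmul_eq_mul]
          exact Finset.sum_le_card_nsmul _ _ _ fun n _ => (le_div_iff₀ hpos).2 (hsmall j n)
        exact h2.trans
          (card_mul_le_of_early hη0 hηeq (hC.isSchreier_of_mem F hFC) hlow).1
      refine (Finset.sum_le_card_nsmul _ _ _ hterm).trans ?_
      rw [nsmul_eq_mul]
      have hb0 : (0 : ℝ) ≤ b j := Nat.cast_nonneg _
      have h3 : ((C.filter fun F => ∃ n ∈ F, n < b j).card : ℝ) * (b j * η) ≤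
          b j * (b j * η) := by
        gcongr
      refine h3.trans (le_trans ?_ hηeq)
      nlinarith [mul_nonneg hη0 hb0, mul_nonneg (mul_nonneg hη0 hb0) hb0]
    have h2 : ∑ F ∈ C, l F ≤ 2 * K := by
      calc ∑ F ∈ C, l F = ∑ j ∈ s, ‖c j‖ * ∑ F ∈ C with (∃ n ∈ F, n < b j), ν j F := by
            simp only [hl, Finset.sum_filter, Finset.mul_sum, mul_ite, mul_zero]
            exact Finset.sum_comm
        _ ≤ ∑ j ∈ s, K * (1 / 2) ^ j := Finset.sum_le_sum fun j hj =>
            mul_le_mul (hcK j hj) (h1 j) (Finset.sum_nonneg fun F _ => hν0 j F) hK0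
        _ = K * ∑ j ∈ s, (1 / 2 : ℝ) ^ j := (Finset.mul_sum _ _ _).symm
        _ ≤ K * 2 := by
            gcongr
            exact sum_le_hasSum s (fun j _ => by positivity) hasSum_geometric_two
        _ = 2 * K := mul_comm _ _
    have hsum0 : 0 ≤ ∑ F ∈ C, l F := Finset.sum_nonneg fun F _ => hl0 F
    calc (∑ F ∈ C, l F ^ (p : ℝ)) ^ (1 / (p : ℝ))
        ≤ ((∑ F ∈ C, l F) ^ (p : ℝ)) ^ (1 / (p : ℝ)) :=
          Real.rpow_le_rpow (Finset.sum_nonneg fun F _ => Real.rpow_nonneg (hl0 F) _)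
            (sum_rpow_le_rpow_sum C hl0 hp1) (by positivity)
      _ = ∑ F ∈ C, l F := by rw [one_div, Real.rpow_rpow_inv hsum0 hp0.ne']
      _ ≤ 2 * K := h2
  calc beta p (baernsteinCoord 𝕜 p (∑ j ∈ s, c j • w j)) C
      ≤ (∑ F ∈ C, (a F + l F) ^ (p : ℝ)) ^ (1 / (p : ℝ)) := by
        unfold beta
        gcongr with F hF
        exact hsplit F
    _ ≤ (∑ F ∈ C, a F ^ (p : ℝ)) ^ (1 / (p : ℝ)) + (∑ F ∈ C, l F ^ (p : ℝ)) ^ (1 / (p : ℝ)) :=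
        Real.Lp_add_le_of_nonneg C hp1 (fun F _ => ha0 F) (fun F _ => hl0 F)
    _ ≤ 3 * K := by linarith

theorem tfae_baernstein (hp1 : 1 < p) (T : BaernsteinSpace 𝕜 p →L[𝕜] BaernsteinSpace 𝕜 p) :
    List.TFAE [IsFinitelyStrictlySingular T, IsStrictlySingular T, ¬ FixesCopyOf (EllP 𝕜 p) T,
      ¬ IdFactorsThrough (EllP 𝕜 p) T] :=
  tfae_of_idFactorsThrough (ellP_spreadingBasis hp1).not_finiteDimensional T
    (baernstein_solidBasis.idFactorsThrough_of_not_fss norm_baernsteinUnit_le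
      tendsto_trunc_baernstein baernstein_flat (ellP_spreadingBasis hp1) zero_le_three
      baernstein_blocksDominated
      (blocksDominate_ellP baernstein_solidBasis trunc_rpow_add_trunc_sub_le) T)

end Baernstein

end

end BaernsteinSchreier

theorem proposition3p6 {𝕜 : Type*} [RCLike 𝕜] (p : NNReal) [Fact (1 ≤ p)] :
    (1 < p → ∀ T : BaernsteinSchreier.BaernsteinSpace 𝕜 p →L[𝕜]
        BaernsteinSchreier.BaernsteinSpace 𝕜 p,
      List.TFAE [
        BaernsteinSchreier.IsFinitelyStrictlySingular T,
        BaernsteinSchreier.IsStrictlySingular T,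
        ¬ BaernsteinSchreier.FixesCopyOf (BaernsteinSchreier.EllP 𝕜 p) T,
        ¬ BaernsteinSchreier.IdFactorsThrough (BaernsteinSchreier.EllP 𝕜 p) T]) ∧
    (∀ T : BaernsteinSchreier.SchreierSpace 𝕜 p →L[𝕜] BaernsteinSchreier.SchreierSpace 𝕜 p,
      List.TFAE [
        BaernsteinSchreier.IsFinitelyStrictlySingular T,
        BaernsteinSchreier.IsStrictlySingular T,
        ¬ BaernsteinSchreier.FixesCopyOf (BaernsteinSchreier.CZero 𝕜) T,
        ¬ BaernsteinSchreier.IdFactorsThrough (BaernsteinSchreier.CZero 𝕜) T]) := by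
  exact ⟨fun hp T => BaernsteinSchreier.tfae_baernstein hp T,
    fun T => BaernsteinSchreier.tfae_schreier T⟩
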